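/- **Setting.** Let $V=\coprod_{n\in\mathbb Z}V_{(n)}$ be a grading-restricted vertex algebra over $\mathbb C$ (finite-dimensional $V_{(n)}$, zero for $n\ll 0$; vertex operator map $Y_V$, vacuum $\mathbf 1\in V_{(0)}$; lower truncation, identity and creation properties, Jacobi identity, $L_V(0)$-bracket formula, $L_V(-1)$-derivative property, where $L_V(0)v=nv$ on $V_{(n)}$ and $L_V(-1)v=v_{-2}\mathbf 1$). A *lower-bounded generalized $V$-module* is a space $W$ with a vertex operator map $Y_W:V\otimes W\to W((x))$ and operators $L_W(0),L_W(-1)$ such that $W$ is the direct sum of the generalized eigenspaces $W_{[\mu]}$ of $L_W(0)$, the real parts of the eigenvalues are bounded below, $Y_W(\mathbf 1,x)=1_W$, the Jacobi identity holds, $[L_W(0),Y_W(v,x)]=x\frac{d}{dx}Y_W(v,x)+Y_W(L_V(0)v,x)$, $[L_W(-1),Y_W(v,x)]=Y_W(L_V(-1)v,x)=\frac{d}{dx}Y_W(v,x)$ and $[L_W(0),L_W(-1)]=L_W(-1)$. Submodules are subspaces invariant under all modes $v_n$ and under $L_W(0),L_W(-1)$. A module is *irreducible* if it is nonzero and has no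 submodules other than $0$ and itself, and *completely reducible* if it is a direct sum of irreducible submodules. **$Gr(W)$.** For $n\in\mathbb N$ let $\Omega_n(W)$ be the set of $w\in W$ with $v_kw=0$ for all homogeneous $v\in V$ and $k\in\mathbb Z$ with $\mathrm{wt}\,v-k-1<-n$; put $\Omega_{-1}(W)=0$, $Gr_n(W)=\Omega_n(W)/\Omega_{n-1}(W)$, $Gr(W)=\coprod_{n\in\mathbb N}Gr_n(W)$ and $Gr^N(W)=\coprod_{n=0}^NGr_n(W)$ for $N\in\mathbb N$. **$A^N(V)$.** Let $U^\infty(V)$ be the space of column-finite matrices $[v_{kl}]_{k,l\in\mathbb N}$ with entries in $V$, $[v]_{kl}$ the matrix with single nonzero entry $v$ at $(k,l)$, and $U^N(V)$ the subspace of matrices whose $(k,l)$-entries vanish unless $k,l\le N$. The product $\diamond$ on $U^\infty(V)$ is $$(\mathfrak u\diamond\mathfrak v)_{kl}=\sum_{n\in\mathbb N}\sum_{m=0}^{n}\binom{-k+n-l-1}{m}\mathrm{Res}_x\,x^{-k+n-l-m-1}(1+x)^l\,Y_V((1+x)^{L_V(0)}u_{kn},x)v_{nl}.$$ $U^\infty(V)$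 acts on $Gr(W)$ by the maps $\vartheta_{Gr(W)}([v]_{kl}):Gr_l(W)\to Gr_k(W)$ induced by $\mathrm{Res}_x\,x^{l-k-1}Y_W(x^{L_V(0)}v,x)$ (and $0$ on $Gr_n(W)$, $n\ne l$). Let $Q^\infty(V)$ be the intersection of the kernels of $\vartheta_{Gr(W)}$ over all lower-bounded generalized $V$-modules $W$, $A^\infty(V)=U^\infty(V)/Q^\infty(V)$, and $A^N(V)$ the image of $U^N(V)$ in $A^\infty(V)$, with the product induced by $\diamond$ and identity induced by $\mathbf 1^N=\sum_{k=0}^N[\mathbf 1]_{kk}$. **Graded $A^N(V)$-modules.** A *graded $A^N(V)$-module* is a (unital) $A^N(V)$-module $M=\coprod_{n=0}^NG_n(M)$, with action $\vartheta_M$, an operator $L_M(0)$ on $M$ and linear maps $L_M(-1):G_n(M)\to G_{n+1}(M)$ for $0\le n<N$, such that: (1) $\vartheta_M([v]_{kl})$ maps $G_l(M)$ to $G_k(M)$ and is $0$ on $G_n(M)$ for $n\neq l$; (2) if $w\in G_l(M)$ and $\vartheta_M([v]_{0l})w=0$ for all $v\in V$, then $w=0$; (3) $M$ is the direct sum of the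 generalized eigenspaces of $L_M(0)$ and the real parts of the eigenvalues are bounded below; (4) $[L_M(0),L_M(-1)]=L_M(-1)$ and $[L_M(0),\vartheta_M([v]_{kl})]=(k-l)\vartheta_M([v]_{kl})$; (5) for $0\le k,l\le N-1$, on $G_l(M)$, $L_M(-1)\vartheta_M([v]_{kl})-\vartheta_M([v]_{(k+1)(l+1)})L_M(-1)=\vartheta_M([L_V(-1)v]_{(k+1)l})$. Graded submodules are graded subspaces invariant under $A^N(V)$, $L_M(0)$ and $L_M(-1)$; *irreducible* and *completely reducible* are defined as above with graded submodules; an *equivalence* is an $A^N(V)$-linear isomorphism preserving the grading and commuting with $L(0)$ and $L(-1)$. **$T_N(W)$.** Let $W=\coprod_{\mu\in\mathcal M}W^\mu$ with $W^\mu$ irreducible (one summand if $W$ is irreducible), and let $h^\mu$ be the lowest weight of $W^\mu$, i.e. $W^\mu=\coprod_{n\in\mathbb N}W^\mu_{[h^\mu+n]}$ with $W^\mu_{[h^\mu]}\ne0$. Put $G_n(W)=\coprod_{\mu}W^\mu_{[h^\mu+n]}$ and $T_N(W)=\coprod_{n=0}^NG_n(W)$, on which $[v]_{kl}$ ($k,l\le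 N$) acts by $\mathrm{Res}_x\,x^{l-k-1}Y_W(x^{L_V(0)}v,x)$ on $G_l(W)$ and by $0$ on $G_n(W)$, $n\neq l$, with $L(0)$ and $L(-1)$ (on $G_n(W)$, $n<N$) given by $L_W(0)$ and $L_W(-1)$. **Proposition.** Let $W$ be a lower-bounded generalized $V$-module and $N\in\mathbb N$. If $W$ is irreducible (resp. completely reducible), then, for every decomposition of $W$ as above, $W=\coprod_{n\in\mathbb N}G_n(W)$; $Gr^N(W)$ (with the operators induced by $L_W(0)$, $L_W(-1)$) and $T_N(W)$ are graded $A^N(V)$-modules and are equivalent as such; and the graded $A^N(V)$-module $Gr^N(W)$ is irreducible (resp. completely reducible). -/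

import Mathlib

open scoped DirectSum

universe u

noncomputable section

/-- The `n`-th mode `v_n`, i.e. the coefficient of `x ^ (-n-1)` in `Y(v, x)`. -/
abbrev vmode {V W : Type*} [AddCommGroup V] [Module ℂ V] [AddCommGroup W] [Module ℂ W]
    (Y : V →ₗ[ℂ] VertexOperator ℂ W) (v : V) (n : ℤ) : Module.End ℂ W :=
  VertexOperator.ncoeff (Y v) n

/-- The Jacobi identity for a vertex operator map `YW` on `W`, written in components
(Borcherds' identity).  All the sums are finite because `Y(v, x) w` is a Laurent series. -/
def JacobiIdentity {V W : Type*} [AddCommGroup V] [Module ℂ V] [AddCommGroup W] [Module ℂ W]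
    (YV : V →ₗ[ℂ] VertexOperator ℂ V) (YW : V →ₗ[ℂ] VertexOperator ℂ W) : Prop :=
  ∀ (u v : V) (w : W) (m n p : ℤ),
    ∑ᶠ i : ℕ, Ring.choose m i • vmode YW (vmode YV u (p + i) v) (m + n - i) w =
      ∑ᶠ i : ℕ, ((-1 : ℤ) ^ i * Ring.choose p i) •
        (vmode YW u (m + p - i) (vmode YW v (n + i) w) -
          ((-1 : ℂ) ^ p) • vmode YW v (n + p - i) (vmode YW u (m + i) w))

/-! ### Column-finite matrices with entries in `V` -/

section Matrices

variable (V : Type u) [AddCommGroup V] [Module ℂ V]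

/-- `U^∞(V)`: column-finite matrices indexed by `ℕ × ℕ` with entries in `V`, stored by columns:
the `(k, l)` entry of `𝔲` is `𝔲 l k`. -/
abbrev UInf : Type u := ℕ → (ℕ →₀ V)

variable {V}

/-- The matrix `[v]_{kl}` with `(k, l)` entry `v` and all other entries `0`. -/
def elem (k l : ℕ) (v : V) : UInf V := Pi.single l (Finsupp.single k v)

variable (V)

/-- `U^N(V)`: the matrices whose `(k, l)` entries vanish unless `k, l ≤ N`. -/
def UN (N : ℕ) : Submodule ℂ (UInf V) where
  carrier := {a | ∀ k l : ℕ, (N < k ∨ N < l) → a l k = 0}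
  add_mem' := by
    intro a b ha hb k l h
    simp [ha k l h, hb k l h]
  zero_mem' := by intro k l _; simp
  smul_mem' := by
    intro c a ha k l h
    simp [ha k l h]

variable {V}

theorem elem_mem {N k l : ℕ} (hk : k ≤ N) (hl : l ≤ N) (v : V) : elem k l v ∈ UN V N := by
  intro k' l' h
  by_cases h1 : l' = l
  · subst h1
    have : k ≠ k' := by omega
    simp [elem, this]
  · simp [elem, h1]

/-- `[v]_{kl}` as an element of `U^N(V)`, for `k, l ≤ N`. -/
def elemN {N k l : ℕ} (hk : k ≤ N) (hl : l ≤ N) (v : V) : UN V N := ⟨elem k l v, elem_mem hk hl v⟩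

end Matrices

/-- A grading-restricted vertex algebra: a `ℤ`-graded space with finite-dimensional homogeneous
subspaces vanishing in sufficiently negative weights, a vertex operator map and a vacuum,
satisfying lower truncation (built into `VertexOperator`), the identity and creation properties,
the Jacobi identity, the `L(0)`-bracket formula (in the form: `v_n` has weight `wt v - n - 1`) and
the `L(-1)`-derivative property, where `L(-1) v = v_{-2} 1`. -/
class GradingRestrictedVertexAlgebra (V : Type u) [AddCommGroup V] [Module ℂ V] where
  /-- the homogeneous subspace of weight `n` -/
  wt : ℤ → Submodule ℂ V
  isInternal : DirectSum.IsInternal wt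
  finite_wt : ∀ n, FiniteDimensional ℂ (wt n)
  bounded_wt : ∃ B : ℤ, ∀ n < B, wt n = ⊥
  /-- the vertex operator map -/
  Y : V →ₗ[ℂ] VertexOperator ℂ V
  /-- the vacuum -/
  vac : V
  vac_mem : vac ∈ wt 0
  identity : ∀ n : ℤ, vmode Y vac n = if n = -1 then 1 else 0
  creation : ∀ v : V, vmode Y v (-1) vac = v
  creation_regular : ∀ (v : V) (n : ℤ), 0 ≤ n → vmode Y v n vac = 0
  jacobi : JacobiIdentity Y Y
  mode_mem : ∀ (d e n : ℤ) (u v : V), u ∈ wt d → v ∈ wt e → vmode Y u n v ∈ wt (d + e - n - 1)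
  derivative : ∀ (v : V) (n : ℤ),
    vmode Y (vmode Y v (-2) vac) n = (-n : ℤ) • vmode Y v (n - 1)
  derivative_bracket : ∀ (u v : V) (n : ℤ),
    vmode Y (vmode Y u n v) (-2) vac - vmode Y u n (vmode Y v (-2) vac) =
      vmode Y (vmode Y u (-2) vac) n v

namespace GradingRestrictedVertexAlgebra

variable (V : Type u) [AddCommGroup V] [Module ℂ V] [GradingRestrictedVertexAlgebra V]

theorem bijective_wt : Function.Bijective (DirectSum.coeLinearMap (wt (V := V))) := isInternal

/-- The linear map on `V = ⨁ V_(d)` given by `f d` on `V_(d)`. -/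
def wtLift {X : Type*} [AddCommGroup X] [Module ℂ X] (f : ℤ → V →ₗ[ℂ] X) : V →ₗ[ℂ] X :=
  (DirectSum.toModule ℂ ℤ X fun d => f d ∘ₗ (wt (V := V) d).subtype) ∘ₗ
    (LinearEquiv.ofBijective (DirectSum.coeLinearMap (wt (V := V))) (bijective_wt V)).symm.toLinearMap

theorem wtLift_of_mem {X : Type*} [AddCommGroup X] [Module ℂ X] (f : ℤ → V →ₗ[ℂ] X) {d : ℤ}
    {v : V} (hv : v ∈ wt (V := V) d) : wtLift V f v = f d v := by
  have h : (LinearEquiv.ofBijective (DirectSum.coeLinearMap (wt (V := V))) (bijective_wt V)).symm v =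
      DirectSum.lof ℂ ℤ (fun d => wt (V := V) d) d ⟨v, hv⟩ := by
    rw [LinearEquiv.symm_apply_eq]
    simp [DirectSum.coeLinearMap_lof]
  simp [wtLift, h]

/-- The projection of `V` onto `V_(d)`. -/
def wtProj (d : ℤ) : V →ₗ[ℂ] V := wtLift V fun e => if e = d then LinearMap.id else 0

/-- `L_V(0)`, which is multiplication by `d` on `V_(d)`. -/
def LZero : Module.End ℂ V := wtLift V fun d => (d : ℂ) • LinearMap.id

/-- `L_V(-1) v = v_{-2} 1`. -/
def LNegOne (v : V) : V := vmode (Y (V := V)) v (-2) (vac (V := V))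

/-! ### The product `⋄` -/

variable {V}

/-- `Res_x x^e (1+x)^l Y_V((1+x)^{L_V(0)} u, x) v`; for `u` of weight `d` this is
`∑_j binom(l+d, j) u_{e+j} v`. -/
def resY (e l : ℤ) (u v : V) : V :=
  ∑ᶠ d : ℤ, ∑ᶠ j : ℕ, Ring.choose (l + d) j • vmode (Y (V := V)) (wtProj V d u) (e + j) v

/-- The entry `Res_x T_{k+l+1}((x+1)^{-k+n-l-1}) (1+x)^l Y_V((1+x)^{L_V(0)} u, x) v`
of `[u]_{kn} ⋄ [v]_{nl}`. -/
def diamondEntry (k n l : ℕ) (u v : V) : V :=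
  ∑ m ∈ Finset.range (n + 1), Ring.choose (-(k : ℤ) + n - l - 1) m •
    resY (-(k : ℤ) + n - l - m - 1) l u v

/-- The product `⋄` on `U^∞(V)`: `(𝔲 ⋄ 𝔳)_{kl} = ∑_n diamondEntry k n l 𝔲_{kn} 𝔳_{nl}`. -/
def diamond (a b : UInf V) : UInf V := fun l =>
  (b l).sum fun n v => (a n).sum fun k u => Finsupp.single k (diamondEntry k n l u v)

theorem diamond_mem {N : ℕ} {a b : UInf V} (ha : a ∈ UN V N) (hb : b ∈ UN V N) :
    diamond a b ∈ UN V N := by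
  intro k l h
  simp only [diamond, Finsupp.sum, Finsupp.finsetSum_apply]
  refine Finset.sum_eq_zero fun n hn => Finset.sum_eq_zero fun k' hk' => ?_
  rcases h with h | h
  · have : k' ≠ k := by
      rintro rfl
      exact (Finsupp.mem_support_iff.1 hk') (ha _ _ (Or.inl h))
    simp [this]
  · exact absurd (hb _ _ (Or.inr h)) (Finsupp.mem_support_iff.1 hn)

/-- The product `⋄` on `U^N(V)`. -/
def diamondN {N : ℕ} (a b : UN V N) : UN V N := ⟨diamond a.1 b.1, diamond_mem a.2 b.2⟩

variable (V)

/-- `1^N = ∑_{k ≤ N} [1]_{kk}`. -/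
def oneN (N : ℕ) : UN V N :=
  ∑ k : Fin (N + 1), elemN (Nat.lt_succ_iff.1 k.2) (Nat.lt_succ_iff.1 k.2) (vac (V := V))

end GradingRestrictedVertexAlgebra

open GradingRestrictedVertexAlgebra

/-! ### Lower-bounded generalized modules -/

/-- The structure of a lower-bounded generalized `V`-module on `W`.  The homogeneous subspace
`W_[μ]` is the generalized eigenspace of `L_W(0)` with eigenvalue `μ`; generalized eigenspaces
are always independent, so `W` is their direct sum as soon as they span. -/
structure LBGModule (V : Type u) [AddCommGroup V] [Module ℂ V] [GradingRestrictedVertexAlgebra V]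
    (W : Type u) [AddCommGroup W] [Module ℂ W] where
  /-- the vertex operator map -/
  Y : V →ₗ[ℂ] VertexOperator ℂ W
  /-- the operator `L_W(0)` -/
  L0 : Module.End ℂ W
  /-- the operator `L_W(-1)` -/
  Lm1 : Module.End ℂ W
  graded : ⨆ μ : ℂ, L0.maxGenEigenspace μ = ⊤
  bounded : ∃ B : ℝ, ∀ μ : ℂ, μ.re < B → L0.maxGenEigenspace μ = ⊥
  identity : ∀ n : ℤ, vmode Y vac n = if n = -1 then 1 else 0
  jacobi : JacobiIdentity (GradingRestrictedVertexAlgebra.Y (V := V)) Y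
  L0_bracket : ∀ (v : V) (n : ℤ),
    L0 * vmode Y v n - vmode Y v n * L0 = vmode Y (LZero V v) n - ((n : ℂ) + 1) • vmode Y v n
  Lm1_derivative : ∀ (v : V) (n : ℤ), vmode Y (LNegOne V v) n = (-n : ℤ) • vmode Y v (n - 1)
  Lm1_bracket : ∀ (v : V) (n : ℤ),
    Lm1 * vmode Y v n - vmode Y v n * Lm1 = vmode Y (LNegOne V v) n
  L0_Lm1 : L0 * Lm1 - Lm1 * L0 = Lm1

/-! ### Graded spaces with a matrix action, and their truncations -/

section System

variable {V : Type u} [AddCommGroup V] [Module ℂ V]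
variable {G : ℕ → Type u} [∀ n, AddCommGroup (G n)] [∀ n, Module ℂ (G n)]

/-- Given linear maps `act k l v : G l → G k`, the operator on `⨁ n, G n` attached to a
column-finite matrix `𝔳` with entries in `V`: `𝔤 ↦ ∑_{k,l} act k l 𝔳_{kl} (π_l 𝔤)`. -/
def matAct (act : ∀ k l : ℕ, V →ₗ[ℂ] G l →ₗ[ℂ] G k) :
    UInf V →ₗ[ℂ] Module.End ℂ (⨁ n, G n) where
  toFun a := DirectSum.toModule ℂ ℕ _ fun l =>
    (a l).sum fun k v => DirectSum.lof ℂ ℕ G k ∘ₗ act k l v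
  map_add' a b := by
    refine DirectSum.linearMap_ext _ fun l => LinearMap.ext fun x => ?_
    simp only [LinearMap.comp_apply, DirectSum.toModule_lof, LinearMap.add_apply, Pi.add_apply]
    rw [Finsupp.sum_add_index' (by intro k; simp) (by intro k v w; simp [LinearMap.comp_add])]
    rfl
  map_smul' c a := by
    refine DirectSum.linearMap_ext _ fun l => LinearMap.ext fun x => ?_
    simp only [LinearMap.comp_apply, DirectSum.toModule_lof, LinearMap.smul_apply, Pi.smul_apply,
      RingHom.id_apply]
    rw [Finsupp.sum_smul_index' (by intro k; simp), Finsupp.sum, Finsupp.sum,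
      LinearMap.sum_apply, LinearMap.sum_apply, Finset.smul_sum]
    simp

/-- A degree-preserving operator on `⨁ n, G n`. -/
def degZero (f : ∀ n, Module.End ℂ (G n)) : Module.End ℂ (⨁ n, G n) :=
  DirectSum.toModule ℂ ℕ _ fun n => DirectSum.lof ℂ ℕ G n ∘ₗ f n

/-- An operator on `⨁ n, G n` mapping `G n` to `G (n+1)` for `n < N` and `G n` to `0` for
`n ≥ N`. -/
def degOne (N : ℕ) (f : ∀ n, G n →ₗ[ℂ] G (n + 1)) : Module.End ℂ (⨁ n, G n) :=
  DirectSum.toModule ℂ ℕ _ fun n =>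
    if n < N then DirectSum.lof ℂ ℕ G (n + 1) ∘ₗ f n else 0

variable (G) in
/-- The subspace `⨁_{n ≤ N} G n` of `⨁ n, G n`. -/
def upTo (N : ℕ) : Submodule ℂ (⨁ n, G n) :=
  ⨆ n : Fin (N + 1), LinearMap.range (DirectSum.lof ℂ ℕ G n)

theorem lof_mem_upTo {N n : ℕ} (h : n ≤ N) (x : G n) : DirectSum.lof ℂ ℕ G n x ∈ upTo G N :=
  (le_iSup (fun n : Fin (N + 1) => LinearMap.range (DirectSum.lof ℂ ℕ G n))
    ⟨n, Nat.lt_succ_of_le h⟩) ⟨x, rfl⟩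

theorem map_mem_upTo {N : ℕ} (f : Module.End ℂ (⨁ n, G n))
    (h : ∀ n ≤ N, ∀ x : G n, f (DirectSum.lof ℂ ℕ G n x) ∈ upTo G N) :
    ∀ x ∈ upTo G N, f x ∈ upTo G N := by
  suffices upTo G N ≤ (upTo G N).comap f from this
  refine iSup_le fun n => ?_
  rintro _ ⟨x, rfl⟩
  exact h n (Nat.lt_succ_iff.1 n.2) x

theorem degZero_mem_upTo (N : ℕ) (f : ∀ n, Module.End ℂ (G n)) :
    ∀ x ∈ upTo G N, degZero f x ∈ upTo G N :=
  map_mem_upTo _ fun n hn x => by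
    simpa [degZero] using lof_mem_upTo hn (f n x)

theorem degOne_mem_upTo (N : ℕ) (f : ∀ n, G n →ₗ[ℂ] G (n + 1)) :
    ∀ x ∈ upTo G N, degOne N f x ∈ upTo G N :=
  map_mem_upTo _ fun n _ x => by
    by_cases h : n < N
    · simpa [degOne, h] using lof_mem_upTo (Nat.succ_le_of_lt h) (f n x)
    · simp [degOne, h]

end System

section ANModules

variable {V : Type u} [AddCommGroup V] [Module ℂ V]
variable {G : ℕ → Type u} [∀ n, AddCommGroup (G n)] [∀ n, Module ℂ (G n)]

theorem matAct_mem_upTo (act : ∀ k l : ℕ, V →ₗ[ℂ] G l →ₗ[ℂ] G k) {N : ℕ} {a : UInf V}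
    (ha : a ∈ UN V N) : ∀ x ∈ upTo G N, matAct act a x ∈ upTo G N :=
  map_mem_upTo _ fun l _ x => by
    simp only [matAct, LinearMap.coe_mk, AddHom.coe_mk, DirectSum.toModule_lof, Finsupp.sum,
      LinearMap.sum_apply, LinearMap.comp_apply]
    refine Submodule.sum_mem _ fun k hk => lof_mem_upTo ?_ _
    by_contra hlt
    exact (Finsupp.mem_support_iff.1 hk) (ha k l (Or.inl (not_le.1 hlt)))

variable (V) in
/-- The data of an `ℕ`-graded space concentrated in degrees `0, …, N` with an action of the
matrix space `U^N(V)` and operators `L(0)`, `L(-1)`.  The operator `L(-1)` is only meaningful on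
degrees `0, …, N - 1`; it is stored as an operator on all of `M` that is `0` on degree `N`. -/
structure GradedData (N : ℕ) (M : Type*) [AddCommGroup M] [Module ℂ M] where
  /-- the action of `U^N(V)` -/
  theta : UN V N →ₗ[ℂ] Module.End ℂ M
  /-- the homogeneous subspaces -/
  gr : ℕ → Submodule ℂ M
  /-- the operator `L_M(0)` -/
  L0 : Module.End ℂ M
  /-- the operator `L_M(-1)`, extended by `0` to degree `N` -/
  Lm1 : Module.End ℂ M

/-- The data on `⨁_{n ≤ N} G n` obtained by restriction from a system of maps
`act k l v : G l → G k`, `L0 n : G n → G n` and `Lm1 n : G n → G (n+1)`. -/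
def truncData (N : ℕ) (act : ∀ k l : ℕ, V →ₗ[ℂ] G l →ₗ[ℂ] G k) (L0 : ∀ n, Module.End ℂ (G n))
    (Lm1 : ∀ n, G n →ₗ[ℂ] G (n + 1)) : GradedData V N (upTo G N) where
  theta :=
    { toFun := fun a => (matAct act a.1).restrict (matAct_mem_upTo act a.2)
      map_add' := fun a b => by ext x; simp
      map_smul' := fun c a => by ext x; simp }
  gr n := (LinearMap.range (DirectSum.lof ℂ ℕ G n)).comap (upTo G N).subtype
  L0 := (degZero L0).restrict (degZero_mem_upTo N L0)
  Lm1 := (degOne N Lm1).restrict (degOne_mem_upTo N Lm1)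

end ANModules

namespace LBGModule

variable {V : Type u} [AddCommGroup V] [Module ℂ V] [GradingRestrictedVertexAlgebra V]
variable {W : Type u} [AddCommGroup W] [Module ℂ W] (S : LBGModule V W)

/-- `Res_x x^{-s-1} Y_W(x^{L_V(0)} v, x)`, the component of weight `s` of the vertex operator:
for `v` of weight `d` it is `v_{d-1-s}`. -/
def opShift (s : ℤ) : V →ₗ[ℂ] Module.End ℂ W :=
  wtLift V fun d => LinearMap.proj (d - 1 - s) ∘ₗ VertexOperator.ncoeff ∘ₗ S.Y

/-- `Ω_n(W)`: the vectors killed by all modes `v_k` of weight `wt v - k - 1 < -n`. -/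
def Omega (n : ℤ) : Submodule ℂ W where
  carrier := {w | ∀ (d k : ℤ) (v : V), v ∈ wt (V := V) d → d - k - 1 < -n → vmode S.Y v k w = 0}
  add_mem' := by
    intro a b ha hb d k v hv h
    rw [map_add, ha d k v hv h, hb d k v hv h, add_zero]
  zero_mem' := by intro d k v _ _; exact map_zero _
  smul_mem' := by
    intro c a ha d k v hv h
    rw [map_smul, ha d k v hv h, smul_zero]

/-- `Ω_{-1}(W) = 0`. -/
theorem Omega_neg_one : S.Omega (-1) = ⊥ := by
  refine (Submodule.eq_bot_iff _).2 fun w hw => ?_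
  have h := hw 0 (-1) vac vac_mem (by norm_num)
  rw [S.identity] at h
  simpa using h

theorem Omega_mono {m n : ℤ} (h : m ≤ n) : S.Omega m ≤ S.Omega n :=
  fun _ hw d k v hv hk => hw d k v hv (by omega)

theorem opShift_of_mem (s : ℤ) {d : ℤ} {v : V} (hv : v ∈ wt (V := V) d) :
    S.opShift s v = vmode S.Y v (d - 1 - s) := by
  rw [opShift, wtLift_of_mem V _ hv]
  rfl

theorem opShift_induction {s : ℤ} (p : Module.End ℂ W → Prop) (h0 : p 0)
    (hadd : ∀ f g, p f → p g → p (f + g))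
    (h : ∀ (d : ℤ) (v : V), v ∈ wt (V := V) d → p (vmode S.Y v (d - 1 - s))) (v : V) :
    p (S.opShift s v) := by
  have hv : v ∈ ⨆ d, wt (V := V) d := by
    rw [DirectSum.IsInternal.submodule_iSup_eq_top isInternal]
    trivial
  induction hv using Submodule.iSup_induction' with
  | mem d x hx => rw [S.opShift_of_mem s hx]; exact h d x hx
  | zero => rw [map_zero]; exact h0
  | add x y _ _ hx hy => rw [map_add]; exact hadd _ _ hx hy

/-- A product of modes of total weight `< -n` kills `Ω_n(W)`. -/
theorem mode_mode_eq_zero {n d e p q : ℤ} {u v : V} {w : W} (hw : w ∈ S.Omega n)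
    (hu : u ∈ wt (V := V) d) (hv : v ∈ wt (V := V) e)
    (h : (d - p - 1) + (e - q - 1) < -n) : vmode S.Y u p (vmode S.Y v q w) = 0 := by
  have key : ∀ (j : ℕ) (p q : ℤ), e + n - q ≤ j → (d - p - 1) + (e - q - 1) < -n →
      vmode S.Y u p (vmode S.Y v q w) = 0 := by
    intro j
    induction j with
    | zero =>
      intro p q hq _
      rw [hw e q v hv (by push_cast at hq; omega), map_zero]
    | succ j ih =>
      intro p q hq hpq
      have hB := S.jacobi u v w (d + n) q (p - (d + n))
      have hL : ∀ i : ℕ, Ring.choose (d + n) i •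
          vmode S.Y (vmode (GradingRestrictedVertexAlgebra.Y (V := V)) u (p - (d + n) + i) v)
            (d + n + q - i) w = 0 := by
        intro i
        rw [hw _ _ _ (mode_mem d e (p - (d + n) + i) u v hu hv) (by omega), smul_zero]
      have hR : ∀ i : ℕ, vmode S.Y u (d + n + i) w = 0 := fun i => hw d _ u hu (by omega)
      simp only [hL, hR, map_zero, smul_zero, sub_zero, finsum_zero] at hB
      rw [finsum_eq_single _ 0] at hB
      · simpa using hB.symm
      · intro i hi
        rw [ih _ _ (by push_cast at hq; omega) (by omega), smul_zero]
  exact key (e + n - q).toNat p q (by omega) h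

theorem opShift_mem_Omega (s : ℤ) (v : V) :
    ∀ (n : ℤ), ∀ w ∈ S.Omega n, S.opShift s v w ∈ S.Omega (n + s) := by
  intro n w hw
  refine S.opShift_induction (fun f => f w ∈ S.Omega (n + s)) (Submodule.zero_mem _)
    (fun f g hf hg => Submodule.add_mem _ hf hg) (fun e v hv => ?_) v
  intro d k u hu hk
  exact S.mode_mode_eq_zero hw hu hv (by omega)

theorem L0_mem_Omega : ∀ (n : ℤ), ∀ w ∈ S.Omega n, S.L0 w ∈ S.Omega (n + 0) := by
  intro n w hw d k v hv hk
  have h := congrArg (fun f => f w) (S.L0_bracket v k)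
  have h1 : LZero V v = (d : ℂ) • v := by rw [LZero, wtLift_of_mem V _ hv]; rfl
  have h2 := hw d k v hv (by omega)
  simp only [h1, LinearMap.sub_apply, Module.End.mul_apply, LinearMap.smul_apply, map_smul,
    Pi.smul_apply, h2, map_zero, smul_zero, sub_zero, zero_sub, neg_eq_zero, vmode] at h
  exact h

theorem Lm1_mem_Omega : ∀ (n : ℤ), ∀ w ∈ S.Omega n, S.Lm1 w ∈ S.Omega (n + 1) := by
  intro n w hw d k v hv hk
  have h := congrArg (fun f => f w) (S.Lm1_bracket v k)
  have h2 := hw d k v hv (by omega)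
  have h3 := hw d (k - 1) v hv (by omega)
  rw [S.Lm1_derivative] at h
  simpa [h2, h3] using h

/-- `Gr_n(W) = Ω_n(W) / Ω_{n-1}(W)`. -/
abbrev Gr (n : ℕ) : Type u := S.Omega n ⧸ (S.Omega ((n : ℤ) - 1)).submoduleOf (S.Omega n)

/-- The map `Gr_l(W) → Gr_k(W)` induced by an operator that maps `Ω_n(W)` to `Ω_{n+s}(W)`,
where `k = l + s`. -/
def grMap {s : ℤ} (f : Module.End ℂ W) (hf : ∀ (n : ℤ), ∀ w ∈ S.Omega n, f w ∈ S.Omega (n + s))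
    (k l : ℕ) (h : (k : ℤ) = l + s) : S.Gr l →ₗ[ℂ] S.Gr k :=
  Submodule.mapQ _ _ (f.restrict (p := S.Omega l) (q := S.Omega k) (h ▸ hf l)) fun w hw => by
    have h1 := hf _ _ (show (w : W) ∈ S.Omega ((l : ℤ) - 1) from hw)
    rw [show (l : ℤ) - 1 + s = (k : ℤ) - 1 by omega] at h1
    exact h1

/-- The map `Gr_l(W) → Gr_k(W)` induced by `Res_x x^{l-k-1} Y_W(x^{L_V(0)} v, x)`. -/
def grAct (k l : ℕ) : V →ₗ[ℂ] S.Gr l →ₗ[ℂ] S.Gr k where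
  toFun v := S.grMap (S.opShift ((k : ℤ) - l) v) (S.opShift_mem_Omega _ v) k l (by omega)
  map_add' a b := by
    refine Submodule.linearMap_qext _ (LinearMap.ext fun w => ?_)
    simp only [grMap, map_add]
    rfl
  map_smul' c a := by
    refine Submodule.linearMap_qext _ (LinearMap.ext fun w => ?_)
    simp only [grMap, map_smul]
    rfl

/-- The operator on `Gr_n(W)` induced by `L_W(0)`. -/
def grL0 (n : ℕ) : Module.End ℂ (S.Gr n) := S.grMap S.L0 S.L0_mem_Omega n n (by omega)

/-- The map `Gr_n(W) → Gr_{n+1}(W)` induced by `L_W(-1)`. -/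
def grLm1 (n : ℕ) : S.Gr n →ₗ[ℂ] S.Gr (n + 1) :=
  S.grMap S.Lm1 S.Lm1_mem_Omega (n + 1) n (by push_cast; ring)

/-- `ϑ_{Gr(W)} : U^∞(V) → End Gr(W)`, where `Gr(W) = ⨁ n, Gr_n(W)`. -/
def theta : UInf V →ₗ[ℂ] Module.End ℂ (⨁ n, S.Gr n) := matAct S.grAct

/-- `Gr^N(W) = ⨁_{n ≤ N} Gr_n(W)` with its grading, its `U^N(V)`-action and the operators
induced by `L_W(0)` and `L_W(-1)`. -/
def GrN (N : ℕ) : GradedData V N (upTo S.Gr N) := truncData N S.grAct S.grL0 S.grLm1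

/-! #### Submodules, irreducibility, complete reducibility -/

/-- Generalized `V`-submodules. -/
structure IsSubmodule (P : Submodule ℂ W) : Prop where
  mode_mem : ∀ (v : V) (n : ℤ), ∀ w ∈ P, vmode S.Y v n w ∈ P
  L0_mem : ∀ w ∈ P, S.L0 w ∈ P
  Lm1_mem : ∀ w ∈ P, S.Lm1 w ∈ P

/-- The generalized `V`-submodule `P` is an irreducible module: it is nonzero and has no
generalized `V`-submodules other than `0` and `P`. -/
def IsIrreducibleSub (P : Submodule ℂ W) : Prop :=
  S.IsSubmodule P ∧ P ≠ ⊥ ∧ ∀ P' ≤ P, S.IsSubmodule P' → P' = ⊥ ∨ P' = P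

/-- `W` is irreducible. -/
def IsIrreducible : Prop := S.IsIrreducibleSub ⊤

/-- `W` is the (internal) direct sum of the irreducible submodules in the set `𝔇`. -/
def IsDecomposition (𝔇 : Set (Submodule ℂ W)) : Prop :=
  (∀ P ∈ 𝔇, S.IsIrreducibleSub P) ∧ sSupIndep 𝔇 ∧ sSup 𝔇 = ⊤

/-- `W` is a direct sum of irreducible submodules. -/
def IsCompletelyReducible : Prop := ∃ 𝔇, S.IsDecomposition 𝔇

/-! #### The module `T_N(W)` -/

/-- `P` is a submodule of the form `⨁_{n ∈ ℕ} P_[h+n]` with `P_[h] ≠ 0`. -/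
def IsLowestWeight (P : Submodule ℂ W) (h : ℂ) : Prop :=
  S.IsSubmodule P ∧ P = ⨆ n : ℕ, P ⊓ S.L0.maxGenEigenspace (h + n) ∧
    P ⊓ S.L0.maxGenEigenspace h ≠ ⊥

/-- `G_n(W) = ⨁_{P ∈ 𝔇} P_[h_P + n]`, where `W` is the direct sum of the irreducible submodules
`P ∈ 𝔇` and `h_P` is the lowest weight of `P`. -/
def GSub (𝔇 : Set (Submodule ℂ W)) (n : ℕ) : Submodule ℂ W :=
  ⨆ (P ∈ 𝔇) (h : ℂ) (_ : S.IsLowestWeight P h), P ⊓ S.L0.maxGenEigenspace (h + n)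

theorem maxGen_shift {f : Module.End ℂ W} {s : ℂ} (hf : S.L0 * f - f * S.L0 = s • f) (μ : ℂ) :
    ∀ w ∈ S.L0.maxGenEigenspace μ, f w ∈ S.L0.maxGenEigenspace (μ + s) := by
  intro w hw
  rw [Module.End.mem_maxGenEigenspace] at hw ⊢
  obtain ⟨k, hk⟩ := hw
  have h1 : (S.L0 - (μ + s) • 1) * f = f * (S.L0 - μ • 1) := by
    rw [sub_mul, mul_sub, smul_mul_assoc, mul_smul_comm, one_mul, mul_one, add_smul, ← hf]
    abel
  have h2 : (S.L0 - (μ + s) • 1) ^ k * f = f * (S.L0 - μ • 1) ^ k := by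
    have h3 : SemiconjBy f (S.L0 - μ • 1) (S.L0 - (μ + s) • 1) := h1.symm
    exact (h3.pow_right k).symm
  refine ⟨k, ?_⟩
  have h4 := congrArg (fun g => g w) h2
  simpa [hk] using h4

theorem map_GSub {f : Module.End ℂ W} {s : ℂ} (hf : S.L0 * f - f * S.L0 = s • f)
    (hP : ∀ P, S.IsSubmodule P → ∀ w ∈ P, f w ∈ P) (𝔇 : Set (Submodule ℂ W)) {k l : ℕ}
    (h : (k : ℂ) = l + s) : ∀ w ∈ S.GSub 𝔇 l, f w ∈ S.GSub 𝔇 k := by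
  suffices S.GSub 𝔇 l ≤ (S.GSub 𝔇 k).comap f from this
  refine iSup₂_le fun P hP1 => iSup₂_le fun μ hμ => fun w hw => ?_
  have h1 : f w ∈ P ⊓ S.L0.maxGenEigenspace (μ + k) := by
    refine ⟨hP P hμ.1 w hw.1, ?_⟩
    rw [h, ← add_assoc]
    exact S.maxGen_shift hf _ w hw.2
  exact le_iSup₂_of_le (f := fun P (_ : P ∈ 𝔇) => ⨆ (h : ℂ) (_ : S.IsLowestWeight P h),
    P ⊓ S.L0.maxGenEigenspace (h + k)) P hP1 (le_iSup₂_of_le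
    (f := fun h (_ : S.IsLowestWeight P h) => P ⊓ S.L0.maxGenEigenspace (h + k)) μ hμ le_rfl) h1

theorem opShift_bracket (s : ℤ) (v : V) :
    S.L0 * S.opShift s v - S.opShift s v * S.L0 = (s : ℂ) • S.opShift s v := by
  refine S.opShift_induction (fun f => S.L0 * f - f * S.L0 = (s : ℂ) • f) (by simp)
    (fun f g hf hg => ?_) (fun d v hv => ?_) v
  · rw [smul_add, ← hf, ← hg, mul_add, add_mul]
    abel
  · have h1 : LZero V v = (d : ℂ) • v := by rw [LZero, wtLift_of_mem V _ hv]; rfl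
    rw [S.L0_bracket, h1]
    simp only [vmode, map_smul, Pi.smul_apply]
    rw [← sub_smul]
    congr 1
    push_cast
    ring

theorem opShift_mem_sub (s : ℤ) (v : V) (P : Submodule ℂ W) (hP : S.IsSubmodule P) :
    ∀ w ∈ P, S.opShift s v w ∈ P := fun w hw =>
  S.opShift_induction (fun f => f w ∈ P) (Submodule.zero_mem _)
    (fun _ _ hf hg => Submodule.add_mem _ hf hg) (fun _ v _ => hP.mode_mem v _ w hw) v

theorem opShift_mem_GSub (𝔇 : Set (Submodule ℂ W)) (k l : ℕ) (v : V) :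
    ∀ w ∈ S.GSub 𝔇 l, S.opShift ((k : ℤ) - l) v w ∈ S.GSub 𝔇 k :=
  S.map_GSub (S.opShift_bracket _ v) (S.opShift_mem_sub _ v) 𝔇 (by push_cast; ring)

theorem L0_mem_GSub (𝔇 : Set (Submodule ℂ W)) (n : ℕ) :
    ∀ w ∈ S.GSub 𝔇 n, S.L0 w ∈ S.GSub 𝔇 n :=
  S.map_GSub (s := 0) (by simp) (fun _ hP => hP.L0_mem) 𝔇 (by simp)

theorem Lm1_mem_GSub (𝔇 : Set (Submodule ℂ W)) (n : ℕ) :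
    ∀ w ∈ S.GSub 𝔇 n, S.Lm1 w ∈ S.GSub 𝔇 (n + 1) :=
  S.map_GSub (s := 1) (by simpa using S.L0_Lm1) (fun _ hP => hP.Lm1_mem) 𝔇 (by simp)

/-- The map `G_l(W) → G_k(W)` given by `Res_x x^{l-k-1} Y_W(x^{L_V(0)} v, x)`. -/
def GSubAct (𝔇 : Set (Submodule ℂ W)) (k l : ℕ) : V →ₗ[ℂ] S.GSub 𝔇 l →ₗ[ℂ] S.GSub 𝔇 k where
  toFun v := (S.opShift ((k : ℤ) - l) v).restrict (S.opShift_mem_GSub 𝔇 k l v)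
  map_add' a b := by ext w; simp
  map_smul' c a := by ext w; simp

/-- `T_N(W) = ⨁_{n ≤ N} G_n(W)`, with its grading, its `U^N(V)`-action and the operators given by
`L_W(0)` and `L_W(-1)`. -/
def TN (𝔇 : Set (Submodule ℂ W)) (N : ℕ) : GradedData V N (upTo (fun n => S.GSub 𝔇 n) N) :=
  truncData N (S.GSubAct 𝔇) (fun n => S.L0.restrict (S.L0_mem_GSub 𝔇 n))
    (fun n => S.Lm1.restrict (S.Lm1_mem_GSub 𝔇 n))

end LBGModule

/-! ### The algebras `A^∞(V)`, `A^N(V)` and graded `A^N(V)`-modules -/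

section GradedModules

variable (V : Type u) [AddCommGroup V] [Module ℂ V] [GradingRestrictedVertexAlgebra V]

/-- `Q^∞(V)`: the intersection of the kernels of `ϑ_{Gr(W)}` over all lower-bounded generalized
`V`-modules `W`. -/
def QInf : Submodule ℂ (UInf V) :=
  ⨅ (W : Type u) (_ : AddCommGroup W) (_ : Module ℂ W) (S : LBGModule V W), LinearMap.ker S.theta

/-- `A^∞(V) = U^∞(V) / Q^∞(V)`; its product is the one induced by `⋄`. -/
abbrev AInf : Type u := UInf V ⧸ QInf V

/-- `A^N(V)`: the image of `U^N(V)` in `A^∞(V)`. -/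
def AN (N : ℕ) : Submodule ℂ (AInf V) := (UN V N).map (QInf V).mkQ

/-- The projection `U^N(V) → A^N(V)`. -/
def toAN (N : ℕ) : UN V N →ₗ[ℂ] AN V N := (QInf V).mkQ.submoduleMap (UN V N)

variable {V}

namespace GradedData

variable {N : ℕ} {M : Type*} [AddCommGroup M] [Module ℂ M] (D : GradedData V N M)

/-- `M` is a graded `A^N(V)`-module.  Since the product and the unit of `A^N(V)` are induced by
`⋄` and `1^N` on `U^N(V)`, an `A^N(V)`-module structure is an action of `U^N(V)` that factors
through `A^N(V)`, is multiplicative for `⋄` and maps `1^N` to the identity. -/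
structure IsGradedModule : Prop where
  factors : ∃ θ : AN V N →ₗ[ℂ] Module.End ℂ M, ∀ a, D.theta a = θ (toAN V N a)
  map_diamond : ∀ a b, D.theta (diamondN a b) = D.theta a * D.theta b
  map_one : D.theta (oneN V N) = 1
  isInternal : DirectSum.IsInternal D.gr
  gr_eq_bot : ∀ n, N < n → D.gr n = ⊥
  elem_ne : ∀ (k l n : ℕ) (hk : k ≤ N) (hl : l ≤ N) (v : V), n ≠ l →
    ∀ w ∈ D.gr n, D.theta (elemN hk hl v) w = 0
  elem_mem : ∀ (k l : ℕ) (hk : k ≤ N) (hl : l ≤ N) (v : V),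
    ∀ w ∈ D.gr l, D.theta (elemN hk hl v) w ∈ D.gr k
  nondegenerate : ∀ (l : ℕ) (hl : l ≤ N), ∀ w ∈ D.gr l,
    (∀ v : V, D.theta (elemN (Nat.zero_le N) hl v) w = 0) → w = 0
  L0_graded : ⨆ μ : ℂ, D.L0.maxGenEigenspace μ = ⊤
  L0_bounded : ∃ B : ℝ, ∀ μ : ℂ, μ.re < B → D.L0.maxGenEigenspace μ = ⊥
  Lm1_mem : ∀ n < N, ∀ w ∈ D.gr n, D.Lm1 w ∈ D.gr (n + 1)
  Lm1_top : ∀ w ∈ D.gr N, D.Lm1 w = 0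
  L0_Lm1 : D.L0 * D.Lm1 - D.Lm1 * D.L0 = D.Lm1
  L0_elem : ∀ (k l : ℕ) (hk : k ≤ N) (hl : l ≤ N) (v : V),
    D.L0 * D.theta (elemN hk hl v) - D.theta (elemN hk hl v) * D.L0 =
      ((k : ℂ) - l) • D.theta (elemN hk hl v)
  Lm1_elem : ∀ (k l : ℕ) (hk : k < N) (hl : l < N) (v : V), ∀ w ∈ D.gr l,
    D.Lm1 (D.theta (elemN hk.le hl.le v) w) -
        D.theta (elemN (Nat.succ_le_of_lt hk) (Nat.succ_le_of_lt hl) v) (D.Lm1 w) =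
      D.theta (elemN (Nat.succ_le_of_lt hk) hl.le (LNegOne V v)) w

/-- Graded `A^N(V)`-submodules: graded subspaces invariant under `A^N(V)`, `L(0)` and `L(-1)`.
(The remaining conditions on a graded module are inherited by such subspaces.) -/
structure IsGradedSubmodule (P : Submodule ℂ M) : Prop where
  theta_mem : ∀ (a : UN V N), ∀ w ∈ P, D.theta a w ∈ P
  graded : P = ⨆ n, P ⊓ D.gr n
  L0_mem : ∀ w ∈ P, D.L0 w ∈ P
  Lm1_mem : ∀ w ∈ P, D.Lm1 w ∈ P

/-- The graded submodule `P` is an irreducible graded module. -/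
def IsIrreducibleSub (P : Submodule ℂ M) : Prop :=
  D.IsGradedSubmodule P ∧ P ≠ ⊥ ∧ ∀ P' ≤ P, D.IsGradedSubmodule P' → P' = ⊥ ∨ P' = P

/-- `M` is an irreducible graded module. -/
def IsIrreducible : Prop := D.IsIrreducibleSub ⊤

/-- `M` is a direct sum of irreducible graded submodules. -/
def IsCompletelyReducible : Prop :=
  ∃ 𝔇 : Set (Submodule ℂ M), (∀ P ∈ 𝔇, D.IsIrreducibleSub P) ∧ sSupIndep 𝔇 ∧ sSup 𝔇 = ⊤

/-- Equivalence of graded `A^N(V)`-modules: an `A^N(V)`-linear isomorphism respecting the gradings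
and commuting with `L(0)` and `L(-1)`. -/
def Equivalent {M' : Type*} [AddCommGroup M'] [Module ℂ M'] (D' : GradedData V N M') : Prop :=
  ∃ f : M ≃ₗ[ℂ] M',
    (∀ (a : UN V N) (w : M), f (D.theta a w) = D'.theta a (f w)) ∧
    (∀ n, (D.gr n).map f.toLinearMap = D'.gr n) ∧
    (∀ w, f (D.L0 w) = D'.L0 (f w)) ∧ ∀ w, f (D.Lm1 w) = D'.Lm1 (f w)

end GradedData

end GradedModules

end

section
open GradingRestrictedVertexAlgebra

/-! ### Modes of vertex operators and the product `⋄` -/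

/-! For `Gr^N(W)` the main point is that `⋄` represents composition. On a vector of `Ω_l(W)` the
Jacobi identity expands a product `u_p v` into finitely many compositions of modes, and the binomial
sum in `⋄` inverts this truncated expansion, leaving the single composition wanted
(`opShift_diamondEntry`). The action factors through `A^N(V)` because `Q^∞(V)` is by definition
killed by every `Gr(W)`. Nondegeneracy holds because a vector of `Ω_l(W)` killed by all modes of
weight `-l` lies in `Ω_{l-1}(W)`.

Now let `W` be a direct sum of irreducible submodules `P`. The weights of `P` lie in one coset of
`ℤ` and are bounded below, so `P` has a lowest weight `h_P`. Modes of weight below `-n` send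
`P_[h_P+n]` below the lowest weight, hence `G_n(W) ⊆ Ω_n(W)`. Conversely, a nonzero part of `Ω_n(W)`
in `P_[h_P+m]` with `m > n` would generate `P` while never reaching weight `h_P`, which is
impossible (`IsIrreducibleSub.inf_Omega_eq_bot`). The degree operator, equal to `L(0) - h_P` on `P`,
carries this over to all of `W`. The result is `Ω_n(W) = G_n(W) ⊕ Ω_{n-1}(W)`, so `G_n(W) → Gr_n(W)`
is an isomorphism compatible with all operators.

For irreducibility it suffices to treat `T_N(P)` inside `T_N(W)` (`TNSub_le`). A nonzero graded
submodule `X` meets degree `0`, by nondegeneracy. This degree-zero part generates `P` through the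
vectors `L(-1)^j v_k a`, and those of degree at most `N` are obtained without leaving degrees `0, …,
N`, so they lie in `X`. Hence `X` is all of `T_N(P)`. -/

theorem exists_vmode_eq_zero {V W : Type*} [AddCommGroup V] [Module ℂ V] [AddCommGroup W]
    [Module ℂ W] (Y : V →ₗ[ℂ] VertexOperator ℂ W) (v : V) (w : W) :
    ∃ K : ℤ, ∀ n, K ≤ n → vmode Y v n w = 0 :=
  ⟨-(HahnSeries.order ((HahnModule.of ℂ).symm (Y v w))), fun n hn =>
    VertexOperator.ncoeff_eq_zero_of_lt_order _ _ _ (by omega)⟩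

theorem finite_support_vmode {V W : Type*} [AddCommGroup V] [Module ℂ V] [AddCommGroup W]
    [Module ℂ W] (Y : V →ₗ[ℂ] VertexOperator ℂ W) (v : V) (w : W) (e : ℤ) (c : ℕ → ℤ) :
    (Function.support fun j : ℕ => c j • vmode Y v (e + j) w).Finite := by
  obtain ⟨K, hK⟩ := exists_vmode_eq_zero Y v w
  refine (Set.finite_lt_nat (K - e).toNat).subset fun j hj => ?_
  by_contra h
  refine hj ?_
  simp only [Set.mem_ofPred_eq, not_lt] at h
  show c j • vmode Y v (e + j) w = 0
  rw [hK _ (by omega), smul_zero]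

theorem vmode_add {V W : Type*} [AddCommGroup V] [Module ℂ V] [AddCommGroup W]
    [Module ℂ W] (Y : V →ₗ[ℂ] VertexOperator ℂ W) (u v : V) (n : ℤ) :
    vmode Y (u + v) n = vmode Y u n + vmode Y v n := by
  simp only [vmode, map_add, Pi.add_apply]

theorem vmode_zero {V W : Type*} [AddCommGroup V] [Module ℂ V] [AddCommGroup W]
    [Module ℂ W] (Y : V →ₗ[ℂ] VertexOperator ℂ W) (n : ℤ) :
    vmode Y 0 n = 0 := by
  simp only [vmode, map_zero, Pi.zero_apply]

/-- Alternating sums of products of binomial coefficients telescope. -/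
theorem sum_choose_mul_choose_sub (a : ℤ) (t : ℕ) :
    ∑ m ∈ Finset.range (t + 1), Ring.choose a m * ((-1) ^ (t - m) * Ring.choose (a - m) (t - m)) =
      if t = 0 then 1 else 0 := by
  have h : ∀ m ∈ Finset.range (t + 1),
      Ring.choose a m * ((-1) ^ (t - m) * Ring.choose (a - m) (t - m)) =
        (-1) ^ t * Ring.choose a t * ((-1) ^ m * (t.choose m : ℤ)) := by
    intro m hm
    have hm' : m ≤ t := Nat.lt_succ_iff.1 (Finset.mem_range.1 hm)
    -- This rewrites `binom(a,m) binom(a-m,t-m)` as `binom(a,t) binom(t,m)`, which leaves the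
    -- alternating sum of the `binom(t,m)`.
    have h1 := Ring.choose_smul_choose a hm'
    rw [nsmul_eq_mul] at h1
    have h2 : ((-1 : ℤ)) ^ (t - m) = (-1) ^ t * (-1) ^ m := by
      obtain ⟨r, rfl⟩ := Nat.exists_eq_add_of_le hm'
      rw [Nat.add_sub_cancel_left, pow_add, mul_right_comm, ← mul_pow]
      simp
    rw [h2]
    linear_combination -((-1) ^ t * (-1) ^ m) * h1
  rw [Finset.sum_congr rfl h, ← Finset.mul_sum, Int.alternating_sum_range_choose]
  split_ifs with h0
  · subst h0; simp
  · simp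

/-- Grouping the terms by `t = m + i`, the coefficient of `f t` is the preceding alternating sum,
which vanishes unless `t = 0`. This is how the sum over `m` in `⋄` undoes the expansion of the inner
products of modes. -/
theorem sum_choose_smul_sum_choose_smul {X : Type*} [AddCommGroup X] (a : ℤ) (n : ℕ) (f : ℕ → X) :
    ∑ m ∈ Finset.range (n + 1), Ring.choose a m •
      ∑ i ∈ Finset.range (n + 1 - m), ((-1 : ℤ) ^ i * Ring.choose (a - m) i) • f (m + i) = f 0 := by
  simp_rw [Finset.smul_sum, smul_smul]
  rw [← Finset.sum_range_diag_flip (n + 1)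
    (fun m i => (Ring.choose a m * ((-1 : ℤ) ^ i * Ring.choose (a - m) i)) • f (m + i))]
  have h : ∀ t ∈ Finset.range (n + 1), ∑ m ∈ Finset.range (t + 1),
      (Ring.choose a m * ((-1 : ℤ) ^ (t - m) * Ring.choose (a - m) (t - m))) • f (m + (t - m)) =
        if t = 0 then f 0 else 0 := by
    intro t _
    have h1 : ∀ m ∈ Finset.range (t + 1),
        (Ring.choose a m * ((-1 : ℤ) ^ (t - m) * Ring.choose (a - m) (t - m))) • f (m + (t - m)) =
        (Ring.choose a m * ((-1 : ℤ) ^ (t - m) * Ring.choose (a - m) (t - m))) • f t := by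
      intro m hm
      rw [Nat.add_sub_cancel' (Nat.lt_succ_iff.1 (Finset.mem_range.1 hm))]
    rw [Finset.sum_congr rfl h1, ← Finset.sum_smul, sum_choose_mul_choose_sub]
    split_ifs with h0
    · rw [h0, one_smul]
    · rw [zero_smul]
  rw [Finset.sum_congr rfl h]
  simp

namespace GradingRestrictedVertexAlgebra

variable {V : Type u} [AddCommGroup V] [Module ℂ V] [GradingRestrictedVertexAlgebra V]

theorem wt_induction {p : V → Prop} (h0 : p 0) (hadd : ∀ x y, p x → p y → p (x + y))
    (h : ∀ d, ∀ v ∈ wt (V := V) d, p v) (v : V) : p v := by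
  have hv : v ∈ ⨆ d, wt (V := V) d := by
    rw [DirectSum.IsInternal.submodule_iSup_eq_top isInternal]
    trivial
  induction hv using Submodule.iSup_induction' with
  | mem d x hx => exact h d x hx
  | zero => exact h0
  | add x y _ _ hx hy => exact hadd _ _ hx hy

theorem wtProj_of_mem {d : ℤ} {v : V} (hv : v ∈ wt (V := V) d) (e : ℤ) :
    wtProj V e v = if d = e then v else 0 := by
  rw [wtProj, wtLift_of_mem V _ hv]
  split_ifs <;> rfl

theorem finite_support_wtProj (v : V) : (Function.support fun d => wtProj V d v).Finite := by
  refine wt_induction (p := fun v => (Function.support fun d => wtProj V d v).Finite) ?_ ?_ ?_ v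
  · simp
  · intro x y hx hy
    refine (hx.union hy).subset ?_
    simp only [map_add]
    exact Function.support_add _ _
  · intro d v hv
    refine (Set.finite_singleton d).subset fun e he => ?_
    by_contra hne
    refine he ?_
    show wtProj V e v = 0
    rw [wtProj_of_mem hv, if_neg (Ne.symm hne)]

theorem LNegOne_mem {d : ℤ} {v : V} (hv : v ∈ wt (V := V) d) : LNegOne V v ∈ wt (V := V) (d + 1) := by
  have := mode_mem d 0 (-2) v vac hv vac_mem
  rwa [show d + 0 - (-2) - 1 = d + 1 by ring] at this

theorem resY_of_mem (e l : ℤ) {d : ℤ} {u : V} (hu : u ∈ wt (V := V) d) (v : V) :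
    resY e l u v = ∑ᶠ j : ℕ, Ring.choose (l + d) j • vmode (Y (V := V)) u (e + j) v := by
  rw [resY, finsum_eq_single _ d]
  · simp only [wtProj_of_mem hu, if_true]
  · intro d' hd'
    simp only [wtProj_of_mem hu, if_neg hd'.symm, vmode_zero, LinearMap.zero_apply, smul_zero,
      finsum_zero]

theorem finite_support_resY (e l : ℤ) (u v : V) : (Function.support fun d : ℤ =>
    ∑ᶠ j : ℕ, Ring.choose (l + d) j • vmode (Y (V := V)) (wtProj V d u) (e + j) v).Finite := by
  refine (finite_support_wtProj u).subset fun d hd => ?_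
  contrapose! hd
  have hd' : wtProj V d u = 0 := by simpa using hd
  simp [hd', vmode_zero]

theorem resY_add_left (e l : ℤ) (u u' v : V) :
    resY e l (u + u') v = resY e l u v + resY e l u' v := by
  rw [resY, resY, resY, ← finsum_add_distrib (finite_support_resY e l u v)
    (finite_support_resY e l u' v)]
  refine finsum_congr fun d => ?_
  rw [← finsum_add_distrib
    (finite_support_vmode Y (wtProj V d u) v e fun j => Ring.choose (l + d) j)
    (finite_support_vmode Y (wtProj V d u') v e fun j => Ring.choose (l + d) j)]
  refine finsum_congr fun j => ?_
  rw [map_add, vmode_add, LinearMap.add_apply, smul_add]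

theorem resY_add_right (e l : ℤ) (u v v' : V) :
    resY e l u (v + v') = resY e l u v + resY e l u v' := by
  rw [resY, resY, resY, ← finsum_add_distrib (finite_support_resY e l u v)
    (finite_support_resY e l u v')]
  refine finsum_congr fun d => ?_
  rw [← finsum_add_distrib
    (finite_support_vmode Y (wtProj V d u) v e fun j => Ring.choose (l + d) j)
    (finite_support_vmode Y (wtProj V d u) v' e fun j => Ring.choose (l + d) j)]
  refine finsum_congr fun j => ?_
  rw [map_add, smul_add]

theorem resY_zero_left (e l : ℤ) (v : V) : resY e l 0 v = 0 := by
  have := resY_add_left e l 0 0 v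
  simpa using this

theorem resY_zero_right (e l : ℤ) (u : V) : resY e l u 0 = 0 := by
  have := resY_add_right e l u 0 0
  simpa using this

theorem diamondEntry_add_left (k n l : ℕ) (u u' v : V) :
    diamondEntry k n l (u + u') v = diamondEntry k n l u v + diamondEntry k n l u' v := by
  simp [diamondEntry, resY_add_left, Finset.sum_add_distrib]

theorem diamondEntry_add_right (k n l : ℕ) (u v v' : V) :
    diamondEntry k n l u (v + v') = diamondEntry k n l u v + diamondEntry k n l u v' := by
  simp [diamondEntry, resY_add_right, Finset.sum_add_distrib]

theorem diamondEntry_zero_left (k n l : ℕ) (v : V) : diamondEntry k n l 0 v = 0 := by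
  simp [diamondEntry, resY_zero_left]

theorem diamondEntry_zero_right (k n l : ℕ) (u : V) : diamondEntry k n l u 0 = 0 := by
  simp [diamondEntry, resY_zero_right]

end GradingRestrictedVertexAlgebra

/-! ### The product `⋄` and composition on `Ω_l(W)` -/

namespace LBGModule

variable {V : Type u} [AddCommGroup V] [Module ℂ V] [GradingRestrictedVertexAlgebra V]
variable {W : Type u} [AddCommGroup W] [Module ℂ W] (S : LBGModule V W)

theorem opShift_eq_zero_of_mem_Omega {n s : ℤ} (h : s < -n) {w : W} (hw : w ∈ S.Omega n) (v : V) :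
    S.opShift s v w = 0 :=
  S.opShift_induction (fun f => f w = 0) rfl (fun f g hf hg => by simp [hf, hg])
    (fun d v hv => hw d _ v hv (by omega)) v

/-- This is the Jacobi identity on a vector of `Ω_l(W)`. The half in which `u` acts first vanishes,
because `u_{l+d+i}` has weight `-l-1-i < -l`. In the other half the mode of `v` has weight
`n-l-m-i`, which is below `-l` once `i > n-m`, so the sum is finite with a bound independent of `w`.
-/
theorem opShift_resY {d e : ℤ} {u v : V} (hu : u ∈ wt (V := V) d) (hv : v ∈ wt (V := V) e)
    {l : ℤ} {w : W} (hw : w ∈ S.Omega l) (k n : ℤ) (m N : ℕ) (hN : n = N + m) :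
    S.opShift (k - l) (resY (-k + n - l - m - 1) l u v) w =
      ∑ i ∈ Finset.range (N + 1), ((-1 : ℤ) ^ i * Ring.choose (-k + n - l - m - 1) i) •
        vmode S.Y u (d - 1 - (k - n + m + i)) (vmode S.Y v (e - 1 - (n - l - m - i)) w) := by
  set p := -k + n - l - m - 1 with hp
  have h1 : S.opShift (k - l) (resY p l u v) w = ∑ᶠ i : ℕ, Ring.choose (l + d) i •
      vmode S.Y (vmode (GradingRestrictedVertexAlgebra.Y (V := V)) u (p + i) v)
        (l + d + (e - 1 + l - n + m) - i) w := by
    rw [resY_of_mem _ _ hu]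
    have h2 := AddMonoidHom.map_finsum
      (((S.opShift (k - l)).flip w).toAddMonoidHom) (finite_support_vmode
        (GradingRestrictedVertexAlgebra.Y (V := V)) u v p (fun j => Ring.choose (l + d) j))
    refine h2.trans (finsum_congr fun i => ?_)
    simp only [LinearMap.toAddMonoidHom_coe, LinearMap.flip_apply, map_zsmul]
    rw [S.opShift_of_mem _ (mode_mem d e (p + i) u v hu hv)]
    congr 3
    rw [hp]; ring
  rw [h1, S.jacobi]
  have hz : ∀ i : ℕ, vmode S.Y u (l + d + i) w = 0 := fun i => hw d _ u hu (by omega)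
  simp only [hz, map_zero, smul_zero, sub_zero]
  rw [finsum_eq_sum_of_support_subset (s := Finset.range (N + 1))]
  · refine Finset.sum_congr rfl fun i _ => ?_
    have e1 : l + d + p - i = d - 1 - (k - n + m + i) := by rw [hp]; ring
    have e2 : e - 1 + l - n + m + i = e - 1 - (n - l - m - i) := by ring
    rw [e1, e2]
  · intro i hi
    by_contra hni
    refine hi ?_
    simp only [Finset.coe_range, Set.mem_Iio, not_lt] at hni
    show _ • _ = _
    rw [hw e _ v hv (by omega), map_zero, smul_zero]

/-- The product `⋄` represents the composition of the operators induced on `Ω_l(W)`. -/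
theorem opShift_diamondEntry (k n l : ℕ) (u v : V) {w : W} (hw : w ∈ S.Omega l) :
    S.opShift ((k : ℤ) - l) (diamondEntry k n l u v) w =
      S.opShift ((k : ℤ) - n) u (S.opShift ((n : ℤ) - l) v w) := by
  induction u using wt_induction with
  | h0 => simp [diamondEntry_zero_left]
  | hadd x y hx hy => simp [diamondEntry_add_left, hx, hy]
  | h d u hu =>
  induction v using wt_induction with
  | h0 => simp [diamondEntry_zero_right]
  | hadd x y hx hy => simp [diamondEntry_add_right, hx, hy]
  | h e v hv =>
  rw [diamondEntry, map_sum, LinearMap.sum_apply, S.opShift_of_mem _ hu, S.opShift_of_mem _ hv]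
  -- The terms depend only on `t = m + i`; the one with `t = 0` is the desired composition.
  have h := sum_choose_smul_sum_choose_smul (-(k : ℤ) + n - l - 1) n (fun t =>
    vmode S.Y u (d - 1 - (k - n + t)) (vmode S.Y v (e - 1 - (n - l - t)) w))
  simp only [Nat.cast_zero, add_zero, sub_zero] at h
  rw [← h]
  refine Finset.sum_congr rfl fun m hm => ?_
  have hm' : m ≤ n := Nat.lt_succ_iff.1 (Finset.mem_range.1 hm)
  rw [map_zsmul, LinearMap.smul_apply,
    S.opShift_resY hu hv hw k n m (n - m) (by push_cast [hm']; ring),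
    show n - m + 1 = n + 1 - m by omega]
  congr 1
  refine Finset.sum_congr rfl fun i _ => ?_
  have e1 : -(k : ℤ) + n - l - m - 1 = -(k : ℤ) + n - l - 1 - m := by ring
  have e2 : (k : ℤ) - n + m + i = k - n + ((m + i : ℕ) : ℤ) := by push_cast; ring
  have e3 : (n : ℤ) - l - m - i = n - l - ((m + i : ℕ) : ℤ) := by push_cast; ring
  rw [e1, e2, e3]

theorem opShift_zero_vac : S.opShift 0 (vac (V := V)) = 1 := by
  rw [S.opShift_of_mem _ vac_mem, S.identity]
  simp

theorem opShift_LNegOne (s : ℤ) (v : V) :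
    S.Lm1 * S.opShift s v - S.opShift s v * S.Lm1 = S.opShift (s + 1) (LNegOne V v) := by
  induction v using wt_induction with
  | h0 => simp [LNegOne, vmode_zero]
  | hadd x y hx hy =>
    have : LNegOne V (x + y) = LNegOne V x + LNegOne V y := by simp [LNegOne, vmode_add]
    rw [this, map_add, map_add, ← hx, ← hy, mul_add, add_mul]
    abel
  | h d v hv =>
    rw [S.opShift_of_mem _ hv, S.opShift_of_mem _ (LNegOne_mem hv), S.Lm1_bracket]
    congr 1
    ring

end LBGModule

/-! ### Generalized eigenspaces of operators on spaces of arbitrary dimension -/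

section Eigenspaces

variable {X : Type*} [AddCommGroup X] [Module ℂ X]

theorem aeval_mem_of_invariant {f : Module.End ℂ X} {p : Submodule ℂ X} (hp : ∀ x ∈ p, f x ∈ p)
    (q : Polynomial ℂ) : ∀ x ∈ p, Polynomial.aeval f q x ∈ p := by
  induction q using Polynomial.induction_on' with
  | add a b ha hb =>
    intro x hx
    rw [map_add]
    exact p.add_mem (ha x hx) (hb x hx)
  | monomial n c =>
    intro x hx
    rw [Polynomial.aeval_monomial, Algebra.algebraMap_eq_smul_one, smul_mul_assoc, one_mul]
    refine p.smul_mem _ ?_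
    induction n with
    | zero => simpa using hx
    | succ n ih =>
      rw [pow_succ', Module.End.mul_apply]
      exact hp _ ih

/-- An invariant subspace contains the generalized eigencomponents of its elements, in any
dimension. Applying `(f - μ₀)^k` kills the `μ₀`-component, so by induction the images of the other
components lie in `p`. Each of these is recovered from its image by a polynomial in `f`. -/
theorem mem_of_sum_mem_of_invariant {f : Module.End ℂ X} {p : Submodule ℂ X}
    (hp : ∀ x ∈ p, f x ∈ p) (s : Finset ℂ) :
    ∀ x : ℂ → X, (∀ μ ∈ s, x μ ∈ f.maxGenEigenspace μ) → ∑ μ ∈ s, x μ ∈ p → ∀ μ ∈ s, x μ ∈ p := by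
  classical
  induction s using Finset.induction_on with
  | empty => simp
  | insert μ₀ s hμ₀ ih =>
    intro x hx hsum
    obtain ⟨k, hk⟩ := (Module.End.mem_maxGenEigenspace _ _ _).1 (hx μ₀ (Finset.mem_insert_self _ _))
    have hs : ∀ μ ∈ s, x μ ∈ p := by
      set q : Polynomial ℂ := (Polynomial.X - Polynomial.C μ₀) ^ k with hq
      have hg : ∀ μ ∈ s, Polynomial.aeval f q (x μ) ∈ p := by
        refine ih (fun μ => Polynomial.aeval f q (x μ)) (fun μ hμ => ?_) ?_
        · exact f.mapsTo_maxGenEigenspace_of_comm (Polynomial.aeval_eq_sum_range (p := q) f ▸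
            (Commute.sum_right _ _ _ fun i _ => ((Commute.refl f).pow_right i).smul_right _)) μ
            (hx μ (Finset.mem_insert_of_mem hμ))
        · have h1 := aeval_mem_of_invariant hp q _ hsum
          rw [Finset.sum_insert hμ₀, map_add, map_sum] at h1
          have h2 : Polynomial.aeval f q (x μ₀) = 0 := by
            rw [hq]
            simpa [Algebra.algebraMap_eq_smul_one] using hk
          rwa [h2, zero_add] at h1
      intro μ hμ
      obtain ⟨j, hj⟩ :=
        (Module.End.mem_maxGenEigenspace _ _ _).1 (hx μ (Finset.mem_insert_of_mem hμ))
      have hne : μ ≠ μ₀ := fun h => hμ₀ (h ▸ hμ)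
      -- By Bézout, `(f - μ₀)^k` is invertible, by a polynomial in `f`, on a vector killed by `(f -
      -- μ)^j`.
      have hco : IsCoprime ((Polynomial.X - Polynomial.C μ) ^ j) q :=
        (Polynomial.isCoprime_X_sub_C_of_isUnit_sub (sub_ne_zero.2 hne).isUnit).pow
      obtain ⟨a, b, hab⟩ := hco
      have h1 := congrArg (fun r => Polynomial.aeval f r (x μ)) hab
      have h2 : Polynomial.aeval f ((Polynomial.X - Polynomial.C μ) ^ j) (x μ) = 0 := by
        simpa [Algebra.algebraMap_eq_smul_one] using hj
      simp only [map_add, map_mul, LinearMap.add_apply, Module.End.mul_apply, h2, map_zero, zero_add,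
        map_one, Module.End.one_apply] at h1
      rw [← h1]
      exact aeval_mem_of_invariant hp b _ (hg μ hμ)
    intro μ hμ
    rcases Finset.mem_insert.1 hμ with rfl | hμ
    · rw [Finset.sum_insert hμ₀] at hsum
      exact (p.add_mem_iff_left (p.sum_mem hs)).1 hsum
    · exact hs μ hμ

theorem le_iSup_inf_maxGenEigenspace {f : Module.End ℂ X} {p : Submodule ℂ X}
    (hp : ∀ x ∈ p, f x ∈ p) (s : Set ℂ) (h : p ≤ ⨆ μ ∈ s, f.maxGenEigenspace μ) :
    p ≤ ⨆ μ ∈ s, p ⊓ f.maxGenEigenspace μ := by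
  classical
  intro w hw
  have hw' := h hw
  rw [iSup_subtype', Submodule.mem_iSup_iff_exists_finsupp] at hw'
  obtain ⟨y, hy, hsum⟩ := hw'
  let x : ℂ → X := fun μ => if hμ : μ ∈ s then y ⟨μ, hμ⟩ else 0
  have hxy : ∀ i : s, x i = y i := fun i => by simp [x, i.2]
  have hsum' : ∑ μ ∈ y.support.map (Function.Embedding.subtype _), x μ = w := by
    rw [Finset.sum_map, ← hsum, Finsupp.sum]
    exact Finset.sum_congr rfl fun i _ => hxy i
  have hmem := mem_of_sum_mem_of_invariant hp (y.support.map (Function.Embedding.subtype _)) x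
    (fun μ hμ => by
      obtain ⟨i, _, rfl⟩ := Finset.mem_map.1 hμ
      exact (hxy i).symm ▸ hy i) (hsum'.symm ▸ hw)
  rw [← hsum']
  refine Submodule.sum_mem _ fun μ hμ => ?_
  obtain ⟨i, hi, rfl⟩ := Finset.mem_map.1 hμ
  refine Submodule.mem_iSup_of_mem i.1 (Submodule.mem_iSup_of_mem i.2 ⟨hmem _ hμ, ?_⟩)
  exact (hxy i).symm ▸ hy i

/-- With `s` a half-plane, this recovers boundedness of the spectrum from spanning by the
generalized eigenspaces in `s`. Boundedness is carried in the spanning form because that form passes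
to invariant subspaces, quotients and sums. -/
theorem maxGenEigenspace_eq_bot_of_notMem {f : Module.End ℂ X} {s : Set ℂ}
    (h : ⨆ μ ∈ s, f.maxGenEigenspace μ = ⊤) {μ : ℂ} (hμ : μ ∉ s) : f.maxGenEigenspace μ = ⊥ := by
  have h1 := f.independent_maxGenEigenspace.disjoint_biSup hμ
  rwa [h, disjoint_top] at h1

theorem iSup_maxGenEigenspace_eq_top_of_mem {f : Module.End ℂ X} {s : Set ℂ}
    (h : ⨆ μ, f.maxGenEigenspace μ = ⊤) (hs : ∀ μ, μ ∉ s → f.maxGenEigenspace μ = ⊥) :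
    ⨆ μ ∈ s, f.maxGenEigenspace μ = ⊤ := by
  refine top_le_iff.1 (h ▸ iSup_le fun μ => ?_)
  by_cases hμ : μ ∈ s
  · exact le_iSup₂_of_le μ hμ le_rfl
  · rw [hs μ hμ]
    exact bot_le

theorem iSup_maxGenEigenspace_restrict {f : Module.End ℂ X} {p : Submodule ℂ X}
    (hp : ∀ x ∈ p, f x ∈ p) {s : Set ℂ} (h : ⨆ μ ∈ s, f.maxGenEigenspace μ = ⊤) :
    ⨆ μ ∈ s, Module.End.maxGenEigenspace (f.restrict hp) μ = ⊤ := by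
  have h1 := le_iSup_inf_maxGenEigenspace hp s (h ▸ le_top)
  have h2 : ∀ μ, p ⊓ f.maxGenEigenspace μ =
      (Module.End.maxGenEigenspace (f.restrict hp) μ).map p.subtype :=
    fun μ => Submodule.inf_genEigenspace f p hp
  simp_rw [h2, ← Submodule.map_iSup] at h1
  refine top_le_iff.1 fun x _ => ?_
  obtain ⟨y, hy, hyx⟩ := h1 x.2
  rwa [← Subtype.ext hyx]

theorem map_mem_maxGenEigenspace {Z : Type*} [AddCommGroup Z] [Module ℂ Z] {f : Module.End ℂ X}
    {g : Module.End ℂ Z} (φ : X →ₗ[ℂ] Z) (h : ∀ x, φ (f x) = g (φ x)) {μ : ℂ} {x : X}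
    (hx : x ∈ f.maxGenEigenspace μ) : φ x ∈ g.maxGenEigenspace μ := by
  rw [Module.End.mem_maxGenEigenspace] at hx ⊢
  obtain ⟨k, hk⟩ := hx
  refine ⟨k, ?_⟩
  have h1 : ∀ (k : ℕ) (x : X), φ (((f - μ • 1) ^ k) x) = ((g - μ • 1) ^ k) (φ x) := by
    intro k
    induction k with
    | zero => simp
    | succ k ih => intro x; rw [pow_succ, pow_succ, Module.End.mul_apply, ih]; simp [h]
  rw [← h1, hk, map_zero]

/-- One statement serves quotients and isomorphisms, with a single map, as well as direct sums, with
the inclusions. -/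
theorem iSup_maxGenEigenspace_of_iSup_range {ι : Type*} {A : ι → Type*} [∀ i, AddCommGroup (A i)]
    [∀ i, Module ℂ (A i)] {f : ∀ i, Module.End ℂ (A i)} {g : Module.End ℂ X}
    (φ : ∀ i, A i →ₗ[ℂ] X) (h : ∀ i x, φ i (f i x) = g (φ i x))
    (hφ : ⨆ i, LinearMap.range (φ i) = ⊤) {s : Set ℂ}
    (hf : ∀ i, ⨆ μ ∈ s, (f i).maxGenEigenspace μ = ⊤) : ⨆ μ ∈ s, g.maxGenEigenspace μ = ⊤ := by
  refine top_le_iff.1 (hφ ▸ iSup_le fun i => ?_)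
  rw [← Submodule.map_top, ← hf i, Submodule.map_iSup]
  refine iSup_mono fun μ => ?_
  rw [Submodule.map_iSup]
  refine iSup_mono fun _ => ?_
  rintro _ ⟨x, hx, rfl⟩
  exact map_mem_maxGenEigenspace (φ i) (h i) hx

end Eigenspaces

/-! ### Truncations of graded systems -/

section System

variable {V : Type u} [AddCommGroup V] [Module ℂ V]
variable {G : ℕ → Type u} [∀ n, AddCommGroup (G n)] [∀ n, Module ℂ (G n)]

theorem matAct_lof (act : ∀ k l : ℕ, V →ₗ[ℂ] G l →ₗ[ℂ] G k) (a : UInf V) (l : ℕ) (x : G l) :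
    matAct act a (DirectSum.lof ℂ ℕ G l x) =
      (a l).sum fun k v => DirectSum.lof ℂ ℕ G k (act k l v x) := by
  simp only [matAct, LinearMap.coe_mk, AddHom.coe_mk, DirectSum.toModule_lof, Finsupp.sum,
    LinearMap.sum_apply, LinearMap.comp_apply]

theorem matAct_elem_lof (act : ∀ k l : ℕ, V →ₗ[ℂ] G l →ₗ[ℂ] G k) (k l : ℕ) (v : V) (x : G l) :
    matAct act (elem k l v) (DirectSum.lof ℂ ℕ G l x) = DirectSum.lof ℂ ℕ G k (act k l v x) := by
  rw [matAct_lof, elem, Pi.single_eq_same, Finsupp.sum_single_index (by simp)]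

theorem matAct_elem_lof_of_ne (act : ∀ k l : ℕ, V →ₗ[ℂ] G l →ₗ[ℂ] G k) (k : ℕ) {l n : ℕ}
    (h : n ≠ l) (v : V) (x : G n) : matAct act (elem k l v) (DirectSum.lof ℂ ℕ G n x) = 0 := by
  rw [matAct_lof, elem, Pi.single_eq_of_ne h, Finsupp.sum_zero_index]

theorem degZero_lof (f : ∀ n, Module.End ℂ (G n)) (n : ℕ) (x : G n) :
    degZero f (DirectSum.lof ℂ ℕ G n x) = DirectSum.lof ℂ ℕ G n (f n x) := by
  simp [degZero]

theorem degOne_lof_of_lt {N n : ℕ} (h : n < N) (f : ∀ n, G n →ₗ[ℂ] G (n + 1)) (x : G n) :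
    degOne N f (DirectSum.lof ℂ ℕ G n x) = DirectSum.lof ℂ ℕ G (n + 1) (f n x) := by
  simp [degOne, h]

theorem degOne_lof_of_le {N n : ℕ} (h : N ≤ n) (f : ∀ n, G n →ₗ[ℂ] G (n + 1)) (x : G n) :
    degOne N f (DirectSum.lof ℂ ℕ G n x) = 0 := by
  simp [degOne, not_lt.2 h]

variable (G) in
/-- The inclusion of `G n` into `⨁_{n ≤ N} G n`. -/
noncomputable def lofUpTo {N n : ℕ} (h : n ≤ N) : G n →ₗ[ℂ] upTo G N :=
  (DirectSum.lof ℂ ℕ G n).codRestrict _ (lof_mem_upTo h)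

@[simp]
theorem coe_lofUpTo {N n : ℕ} (h : n ≤ N) (x : G n) :
    (lofUpTo G h x : ⨁ n, G n) = DirectSum.lof ℂ ℕ G n x := rfl

theorem iSup_range_lofUpTo (N : ℕ) :
    ⨆ n : Fin (N + 1), LinearMap.range (lofUpTo G (Nat.lt_succ_iff.1 n.2)) = ⊤ := by
  apply Submodule.map_injective_of_injective (upTo G N).injective_subtype
  rw [Submodule.map_iSup, Submodule.map_top, Submodule.range_subtype]
  refine iSup_congr fun n => ?_
  rw [← LinearMap.range_comp]
  rfl

theorem upTo_hom_ext {N : ℕ} {Z : Type*} [AddCommGroup Z] [Module ℂ Z]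
    {f g : upTo G N →ₗ[ℂ] Z} (h : ∀ (n : ℕ) (hn : n ≤ N) (x : G n),
      f (lofUpTo G hn x) = g (lofUpTo G hn x)) : f = g := by
  rw [← LinearMap.eqLocus_eq_top, ← top_le_iff, ← iSup_range_lofUpTo]
  refine iSup_le fun n => ?_
  rintro _ ⟨x, rfl⟩
  exact h n (Nat.lt_succ_iff.1 n.2) x

theorem component_eq_zero_of_mem_upTo {N n : ℕ} (h : N < n) {x : ⨁ n, G n} (hx : x ∈ upTo G N) :
    x n = 0 := by
  have : upTo G N ≤ LinearMap.ker (DirectSum.component ℂ ℕ G n) := by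
    refine iSup_le fun m => ?_
    rintro _ ⟨y, rfl⟩
    have : (m : ℕ) ≠ n := by omega
    rw [LinearMap.mem_ker, DirectSum.component.of, dif_neg this]
  exact this hx

variable {act : ∀ k l : ℕ, V →ₗ[ℂ] G l →ₗ[ℂ] G k} {L0 : ∀ n, Module.End ℂ (G n)}
  {Lm1 : ∀ n, G n →ₗ[ℂ] G (n + 1)} {N : ℕ}

theorem mem_truncData_gr {n : ℕ} {x : upTo G N} :
    x ∈ (truncData N act L0 Lm1).gr n ↔ ∃ y, DirectSum.lof ℂ ℕ G n y = x := Iff.rfl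

theorem lofUpTo_mem_gr {n : ℕ} (hn : n ≤ N) (x : G n) :
    lofUpTo G hn x ∈ (truncData N act L0 Lm1).gr n := ⟨x, rfl⟩

theorem exists_lofUpTo_of_mem_gr {n : ℕ} (hn : n ≤ N) {x : upTo G N}
    (hx : x ∈ (truncData N act L0 Lm1).gr n) : ∃ y, lofUpTo G hn y = x := by
  obtain ⟨y, hy⟩ := hx
  exact ⟨y, Subtype.ext hy⟩

theorem truncData_theta_coe (a : UN V N) (x : upTo G N) :
    ((truncData N act L0 Lm1).theta a x : ⨁ n, G n) = matAct act a.1 x := rfl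

theorem truncData_elem_lofUpTo {k l : ℕ} (hk : k ≤ N) (hl : l ≤ N) (v : V) (x : G l) :
    (truncData N act L0 Lm1).theta (elemN hk hl v) (lofUpTo G hl x) =
      lofUpTo G hk (act k l v x) :=
  Subtype.ext (matAct_elem_lof act k l v x)

theorem truncData_elem_lofUpTo_of_ne {k l n : ℕ} (hk : k ≤ N) (hl : l ≤ N) (hn : n ≤ N)
    (h : n ≠ l) (v : V) (x : G n) :
    (truncData N act L0 Lm1).theta (elemN hk hl v) (lofUpTo G hn x) = 0 :=
  Subtype.ext (matAct_elem_lof_of_ne act k h v x)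

theorem truncData_L0_lofUpTo {n : ℕ} (hn : n ≤ N) (x : G n) :
    (truncData N act L0 Lm1).L0 (lofUpTo G hn x) = lofUpTo G hn (L0 n x) :=
  Subtype.ext (degZero_lof L0 n x)

theorem truncData_Lm1_lofUpTo {n : ℕ} (hn : n < N) (x : G n) :
    (truncData N act L0 Lm1).Lm1 (lofUpTo G hn.le x) =
      lofUpTo G (Nat.succ_le_of_lt hn) (Lm1 n x) :=
  Subtype.ext (degOne_lof_of_lt hn Lm1 x)

theorem truncData_Lm1_lofUpTo_top (x : G N) :
    (truncData N act L0 Lm1).Lm1 (lofUpTo G le_rfl x) = 0 :=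
  Subtype.ext (degOne_lof_of_le le_rfl Lm1 x)

theorem truncData_gr_isInternal (act : ∀ k l : ℕ, V →ₗ[ℂ] G l →ₗ[ℂ] G k)
    (L0 : ∀ n, Module.End ℂ (G n)) (Lm1 : ∀ n, G n →ₗ[ℂ] G (n + 1)) (N : ℕ) :
    DirectSum.IsInternal (truncData N act L0 Lm1).gr := by
  refine DirectSum.isInternal_submodule_of_iSupIndep_of_iSup_eq_top ?_ ?_
  · intro n
    rw [Submodule.disjoint_def]
    rintro x ⟨y, hy⟩ hx
    have h1 : (⨆ (m : ℕ) (_ : m ≠ n), (truncData N act L0 Lm1).gr m) ≤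
        LinearMap.ker (DirectSum.component ℂ ℕ G n ∘ₗ (upTo G N).subtype) := by
      refine iSup₂_le fun m hm => ?_
      rintro z ⟨t, ht⟩
      rw [LinearMap.mem_ker, LinearMap.comp_apply, ← ht, DirectSum.component.of, dif_neg hm]
    have h2 := h1 hx
    rw [LinearMap.mem_ker, LinearMap.comp_apply, ← hy, DirectSum.component.lof_self] at h2
    rw [h2, map_zero] at hy
    exact Subtype.ext hy.symm
  · refine top_le_iff.1 (iSup_range_lofUpTo (G := G) N ▸ iSup_le fun n => ?_)
    refine le_trans ?_ (le_iSup _ (n : ℕ))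
    rintro _ ⟨x, rfl⟩
    exact lofUpTo_mem_gr _ x

theorem truncData_gr_eq_bot {n : ℕ} (hn : N < n) : (truncData N act L0 Lm1).gr n = ⊥ := by
  rw [Submodule.eq_bot_iff]
  rintro x ⟨y, hy⟩
  have h := component_eq_zero_of_mem_upTo hn x.2
  rw [Submodule.subtype_apply] at hy
  have h2 := DirectSum.component.lof_self ℂ n y
  rw [hy] at h2
  have h3 : y = 0 := h2.symm.trans h
  rw [h3, map_zero] at hy
  exact Subtype.ext hy.symm

theorem truncData_elem_ne {k l n : ℕ} (hk : k ≤ N) (hl : l ≤ N) (v : V) (h : n ≠ l)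
    {w : upTo G N} (hw : w ∈ (truncData N act L0 Lm1).gr n) :
    (truncData N act L0 Lm1).theta (elemN hk hl v) w = 0 := by
  obtain ⟨y, hy⟩ := mem_truncData_gr.1 hw
  refine Subtype.ext ?_
  rw [truncData_theta_coe, ← hy]
  exact matAct_elem_lof_of_ne act k h v y

theorem truncData_nondegenerate (hnondeg : ∀ l (x : G l), (∀ v, act 0 l v x = 0) → x = 0)
    {l : ℕ} (hl : l ≤ N) {w : upTo G N} (hw : w ∈ (truncData N act L0 Lm1).gr l)
    (h : ∀ v : V, (truncData N act L0 Lm1).theta (elemN (Nat.zero_le N) hl v) w = 0) : w = 0 := by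
  obtain ⟨y, rfl⟩ := exists_lofUpTo_of_mem_gr hl hw
  rw [hnondeg l y fun v => ?_, map_zero]
  have h1 := congrArg (fun z : upTo G N => (z : ⨁ n, G n) 0) (h v)
  rw [truncData_elem_lofUpTo] at h1
  exact (DirectSum.component.lof_self ℂ 0 _).symm.trans h1

theorem truncData_iSup_maxGenEigenspace {s : Set ℂ}
    (hL0 : ∀ n, ⨆ μ ∈ s, (L0 n).maxGenEigenspace μ = ⊤) :
    ⨆ μ ∈ s, (truncData N act L0 Lm1).L0.maxGenEigenspace μ = ⊤ :=
  iSup_maxGenEigenspace_of_iSup_range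
    (fun n : Fin (N + 1) => lofUpTo G (Nat.lt_succ_iff.1 n.2))
    (fun _ x => (truncData_L0_lofUpTo _ x).symm) (iSup_range_lofUpTo N) (fun n => hL0 n)

end System

/-! ### Degreewise criterion for a truncation to be a graded `A^N(V)`-module -/

section GradedModule

variable {V : Type u} [AddCommGroup V] [Module ℂ V] [GradingRestrictedVertexAlgebra V]
variable {G : ℕ → Type u} [∀ n, AddCommGroup (G n)] [∀ n, Module ℂ (G n)]
variable {act : ∀ k l : ℕ, V →ₗ[ℂ] G l →ₗ[ℂ] G k} {L0 : ∀ n, Module.End ℂ (G n)}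
  {Lm1 : ∀ n, G n →ₗ[ℂ] G (n + 1)} {N : ℕ}

theorem matAct_diamond (hact : ∀ k n l u v (x : G l),
      act k l (diamondEntry k n l u v) x = act k n u (act n l v x)) (a b : UInf V)
    (x : ⨁ n, G n) : matAct act (diamond a b) x = matAct act a (matAct act b x) := by
  suffices matAct act (diamond a b) = matAct act a * matAct act b by rw [this]; rfl
  refine DirectSum.linearMap_ext _ fun l => LinearMap.ext fun x => ?_
  rw [LinearMap.comp_apply, LinearMap.comp_apply, Module.End.mul_apply, matAct_lof, matAct_lof,
    map_finsuppSum]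
  -- Additivity in the column lets the column sum pass through the finite sums that define `⋄`.
  let Φ : (ℕ →₀ V) →+ ⨁ n, G n := Finsupp.liftAddHom fun k =>
    ((DirectSum.lof ℂ ℕ G k ∘ₗ (act k l).flip x).toAddMonoidHom)
  have hΦ : ∀ c : ℕ →₀ V, (c.sum fun k v => DirectSum.lof ℂ ℕ G k (act k l v x)) = Φ c :=
    fun c => rfl
  rw [hΦ, diamond, map_finsuppSum]
  refine Finsupp.sum_congr fun n _ => ?_
  rw [map_finsuppSum, matAct_lof]
  refine Finsupp.sum_congr fun k _ => ?_
  rw [← hΦ, Finsupp.sum_single_index (by simp), hact]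

theorem exists_comp_eq_of_ker_le {A B C : Type*} [AddCommGroup A] [Module ℂ A] [AddCommGroup B]
    [Module ℂ B] [AddCommMonoid C] [Module ℂ C] {f : A →ₗ[ℂ] B} (hf : Function.Surjective f)
    {g : A →ₗ[ℂ] C} (h : ∀ a, f a = 0 → g a = 0) : ∃ θ : B →ₗ[ℂ] C, ∀ a, g a = θ (f a) := by
  obtain ⟨r, hr⟩ := f.exists_rightInverse_of_surjective (LinearMap.range_eq_top.2 hf)
  refine ⟨g ∘ₗ r, fun a => ?_⟩
  have h1 : f (a - r (f a)) = 0 := by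
    rw [map_sub, ← LinearMap.comp_apply f r, hr, LinearMap.id_apply, sub_self]
  conv_lhs => rw [← sub_add_cancel a (r (f a)), map_add, h _ h1, zero_add]
  rfl

theorem toAN_surjective : Function.Surjective (toAN V N) := by
  rintro ⟨_, a, ha, rfl⟩
  exact ⟨⟨a, ha⟩, rfl⟩

theorem mem_QInf_of_toAN_eq_zero {a : UN V N} (h : toAN V N a = 0) : (a : UInf V) ∈ QInf V :=
  (Submodule.Quotient.mk_eq_zero _).1 (congrArg Subtype.val h)

theorem truncData_factors (hfactor : ∀ a ∈ QInf V, matAct act a = 0) :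
    ∃ θ : AN V N →ₗ[ℂ] Module.End ℂ (upTo G N),
      ∀ a, (truncData N act L0 Lm1).theta a = θ (toAN V N a) := by
  refine exists_comp_eq_of_ker_le (f := toAN V N)
    (g := (truncData N act L0 Lm1).theta) toAN_surjective fun a ha => ?_
  refine LinearMap.ext fun x => Subtype.ext ?_
  rw [truncData_theta_coe, hfactor _ (mem_QInf_of_toAN_eq_zero ha)]
  rfl

theorem truncData_map_one (hvac : ∀ k (x : G k), act k k vac x = x) :
    (truncData N act L0 Lm1).theta (oneN V N) = 1 := by
  refine upTo_hom_ext fun n hn x => ?_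
  rw [oneN, map_sum, LinearMap.sum_apply, Finset.sum_eq_single ⟨n, Nat.lt_succ_of_le hn⟩]
  · rw [truncData_elem_lofUpTo, hvac]
    rfl
  · intro k _ hk
    refine truncData_elem_lofUpTo_of_ne _ _ _ ?_ _ _
    rintro rfl
    exact hk rfl
  · simp

/-- Every operator is determined on the summands `G n`, so the axioms become identities between the
maps of the system. The bound `B` must be the same for all `n`, since it has to bound the spectrum
on the whole sum. -/
theorem truncData_isGradedModule
    (hfactor : ∀ a ∈ QInf V, matAct act a = 0)
    (hact : ∀ k n l u v (x : G l), act k l (diamondEntry k n l u v) x = act k n u (act n l v x))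
    (hvac : ∀ k (x : G k), act k k vac x = x)
    (hnondeg : ∀ l (x : G l), (∀ v, act 0 l v x = 0) → x = 0)
    {B : ℝ} (hL0 : ∀ n, ⨆ μ ∈ {μ : ℂ | B ≤ μ.re}, (L0 n).maxGenEigenspace μ = ⊤)
    (hL0Lm1 : ∀ n x, L0 (n + 1) (Lm1 n x) - Lm1 n (L0 n x) = Lm1 n x)
    (hL0act : ∀ k l v x, L0 k (act k l v x) - act k l v (L0 l x) = ((k : ℂ) - l) • act k l v x)
    (hLm1act : ∀ k l v x, Lm1 k (act k l v x) - act (k + 1) (l + 1) v (Lm1 l x) =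
      act (k + 1) l (LNegOne V v) x) :
    (truncData N act L0 Lm1).IsGradedModule where
  factors := truncData_factors hfactor
  map_diamond a b := LinearMap.ext fun x => Subtype.ext (matAct_diamond hact a.1 b.1 x)
  map_one := truncData_map_one hvac
  isInternal := truncData_gr_isInternal act L0 Lm1 N
  gr_eq_bot n hn := truncData_gr_eq_bot hn
  elem_ne k l n hk hl v h w hw := truncData_elem_ne hk hl v h hw
  elem_mem k l hk hl v w hw := by
    obtain ⟨y, rfl⟩ := exists_lofUpTo_of_mem_gr hl hw
    rw [truncData_elem_lofUpTo]
    exact lofUpTo_mem_gr _ _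
  nondegenerate l hl w hw h := truncData_nondegenerate hnondeg hl hw h
  L0_graded := top_le_iff.1 (truncData_iSup_maxGenEigenspace (act := act) (Lm1 := Lm1) (N := N) hL0 ▸
    iSup₂_le fun μ _ => le_iSup _ μ)
  L0_bounded := ⟨B, fun μ hμ => maxGenEigenspace_eq_bot_of_notMem
    (truncData_iSup_maxGenEigenspace hL0) (not_le.2 hμ)⟩
  Lm1_mem n hn w hw := by
    obtain ⟨y, rfl⟩ := exists_lofUpTo_of_mem_gr hn.le hw
    rw [truncData_Lm1_lofUpTo hn]
    exact lofUpTo_mem_gr _ _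
  Lm1_top w hw := by
    obtain ⟨y, rfl⟩ := exists_lofUpTo_of_mem_gr le_rfl hw
    exact truncData_Lm1_lofUpTo_top y
  L0_Lm1 := by
    refine upTo_hom_ext fun n hn x => ?_
    rw [LinearMap.sub_apply, Module.End.mul_apply, Module.End.mul_apply, truncData_L0_lofUpTo]
    rcases hn.lt_or_eq with h | rfl
    · rw [truncData_Lm1_lofUpTo h, truncData_Lm1_lofUpTo h, truncData_L0_lofUpTo, ← map_sub,
        hL0Lm1]
    · rw [truncData_Lm1_lofUpTo_top, truncData_Lm1_lofUpTo_top, map_zero, sub_zero]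
  L0_elem k l hk hl v := by
    refine upTo_hom_ext fun n hn x => ?_
    rw [LinearMap.sub_apply, Module.End.mul_apply, Module.End.mul_apply, LinearMap.smul_apply,
      truncData_L0_lofUpTo]
    by_cases h : n = l
    · subst h
      rw [truncData_elem_lofUpTo, truncData_elem_lofUpTo, truncData_L0_lofUpTo, ← map_sub,
        hL0act, map_smul]
    · rw [truncData_elem_lofUpTo_of_ne _ _ _ h, truncData_elem_lofUpTo_of_ne _ _ _ h, map_zero,
        smul_zero, sub_zero]
  Lm1_elem k l hk hl v w hw := by
    obtain ⟨y, rfl⟩ := exists_lofUpTo_of_mem_gr hl.le hw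
    rw [truncData_elem_lofUpTo, truncData_Lm1_lofUpTo hk, truncData_Lm1_lofUpTo hl,
      truncData_elem_lofUpTo, truncData_elem_lofUpTo, ← map_sub, hLm1act]

end GradedModule

/-! ### The graded module `Gr^N(W)` -/

namespace LBGModule

variable {V : Type u} [AddCommGroup V] [Module ℂ V] [GradingRestrictedVertexAlgebra V]
variable {W : Type u} [AddCommGroup W] [Module ℂ W] (S : LBGModule V W)

theorem Gr_mk_eq_zero {n : ℕ} {x : S.Omega n} :
    (Submodule.Quotient.mk x : S.Gr n) = 0 ↔ (x : W) ∈ S.Omega ((n : ℤ) - 1) := by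
  rw [Submodule.Quotient.mk_eq_zero]
  rfl

theorem L0_bounded_below : ∃ B : ℝ, ⨆ μ ∈ {μ : ℂ | B ≤ μ.re}, S.L0.maxGenEigenspace μ = ⊤ := by
  obtain ⟨B, hB⟩ := S.bounded
  exact ⟨B, iSup_maxGenEigenspace_eq_top_of_mem S.graded fun μ hμ => hB μ (not_le.1 hμ)⟩

/-- `Gr^N(W)` is a graded `A^N(V)`-module. -/
theorem GrN_isGradedModule (N : ℕ) : (S.GrN N).IsGradedModule := by
  obtain ⟨B, hB⟩ := S.L0_bounded_below
  refine truncData_isGradedModule (B := B) ?_ ?_ ?_ ?_ ?_ ?_ ?_ ?_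
  · intro a ha
    simp only [QInf, Submodule.mem_iInf] at ha
    exact ha W _ _ S
  · intro k n l u v x
    obtain ⟨x, rfl⟩ := Submodule.Quotient.mk_surjective _ x
    exact congrArg Submodule.Quotient.mk (Subtype.ext (S.opShift_diamondEntry k n l u v x.2))
  · intro k x
    obtain ⟨x, rfl⟩ := Submodule.Quotient.mk_surjective _ x
    refine congrArg Submodule.Quotient.mk (Subtype.ext ?_)
    show S.opShift ((k : ℤ) - k) vac (x : W) = x
    rw [sub_self, S.opShift_zero_vac]
    rfl
  · intro l x h
    obtain ⟨x, rfl⟩ := Submodule.Quotient.mk_surjective _ x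
    rw [Gr_mk_eq_zero]
    intro d k v hv hk
    -- Membership in `Ω_{l-1}` asks that modes of weight at most `-l` kill the vector. Weights below
    -- `-l` are covered by `Ω_l`; in weight exactly `-l` the image lies in `Ω_{-1} = 0` by
    -- hypothesis.
    by_cases hlt : d - k - 1 < -l
    · exact x.2 d k v hv hlt
    · have h1 : S.opShift ((0 : ℕ) - l) v (x : W) ∈ S.Omega (((0 : ℕ) : ℤ) - 1) :=
        S.Gr_mk_eq_zero.1 (h v)
      rw [show ((0 : ℕ) : ℤ) - 1 = -1 by norm_num, S.Omega_neg_one, Submodule.mem_bot,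
        S.opShift_of_mem _ hv] at h1
      rw [← h1]
      congr 2
      push_cast
      omega
  · intro n
    have h1 := iSup_maxGenEigenspace_restrict (p := S.Omega n)
      (fun x hx => by simpa using S.L0_mem_Omega n x hx) hB
    refine iSup_maxGenEigenspace_of_iSup_range (ι := Unit) (A := fun _ => S.Omega n)
      (fun _ => Submodule.mkQ _) (fun _ x => ?_) ?_ (fun _ => h1)
    · rfl
    · simp
  · intro n x
    obtain ⟨x, rfl⟩ := Submodule.Quotient.mk_surjective _ x
    exact congrArg Submodule.Quotient.mk
      (Subtype.ext (congrArg (fun f : Module.End ℂ W => f x) S.L0_Lm1))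
  · intro k l v x
    obtain ⟨x, rfl⟩ := Submodule.Quotient.mk_surjective _ x
    have := congrArg (fun f : Module.End ℂ W => f x) (S.opShift_bracket ((k : ℤ) - l) v)
    push_cast at this
    exact congrArg Submodule.Quotient.mk (Subtype.ext this)
  · intro k l v x
    obtain ⟨x, rfl⟩ := Submodule.Quotient.mk_surjective _ x
    refine congrArg Submodule.Quotient.mk (Subtype.ext ?_)
    have := congrArg (fun f : Module.End ℂ W => f x) (S.opShift_LNegOne ((k : ℤ) - l) v)
    have e1 : ((k + 1 : ℕ) : ℤ) - ((l + 1 : ℕ) : ℤ) = k - l := by push_cast; ring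
    have e2 : ((k + 1 : ℕ) : ℤ) - l = k - l + 1 := by push_cast; ring
    show S.Lm1 (S.opShift _ v x) - S.opShift (((k + 1 : ℕ) : ℤ) - ((l + 1 : ℕ) : ℤ)) v (S.Lm1 x) =
      S.opShift (((k + 1 : ℕ) : ℤ) - l) _ x
    rw [e1, e2]
    exact this

end LBGModule

/-! ### Equivalences of graded modules -/

namespace GradedData

variable {V : Type u} [AddCommGroup V] [Module ℂ V]
variable {N : ℕ} {M M' : Type*} [AddCommGroup M] [Module ℂ M] [AddCommGroup M'] [Module ℂ M']

/-- The linear isomorphism `f` is an equivalence between the graded modules `D` and `D'`. -/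
def IsEquivalence (D : GradedData V N M) (D' : GradedData V N M') (f : M ≃ₗ[ℂ] M') : Prop :=
  (∀ (a : UN V N) (w : M), f (D.theta a w) = D'.theta a (f w)) ∧
    (∀ n, (D.gr n).map f.toLinearMap = D'.gr n) ∧
    (∀ w, f (D.L0 w) = D'.L0 (f w)) ∧ ∀ w, f (D.Lm1 w) = D'.Lm1 (f w)

variable {D : GradedData V N M} {D' : GradedData V N M'} {f : M ≃ₗ[ℂ] M'}

theorem IsEquivalence.equivalent (h : IsEquivalence D D' f) : D.Equivalent D' := ⟨f, h⟩

theorem IsEquivalence.symm (h : IsEquivalence D D' f) : IsEquivalence D' D f.symm := by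
  obtain ⟨h1, h2, h3, h4⟩ := h
  refine ⟨fun a w => ?_, fun n => ?_, fun w => ?_, fun w => ?_⟩
  · rw [LinearEquiv.symm_apply_eq, h1, LinearEquiv.apply_symm_apply]
  · rw [← h2, ← Submodule.map_comp]
    simp
  · rw [LinearEquiv.symm_apply_eq, h3, LinearEquiv.apply_symm_apply]
  · rw [LinearEquiv.symm_apply_eq, h4, LinearEquiv.apply_symm_apply]

theorem IsEquivalence.mem_gr (h : IsEquivalence D D' f) {n : ℕ} {w : M} (hw : w ∈ D.gr n) :
    f w ∈ D'.gr n := h.2.1 n ▸ Submodule.mem_map_of_mem hw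

theorem IsEquivalence.exists_of_mem_gr (h : IsEquivalence D D' f) {n : ℕ} {w' : M'}
    (hw : w' ∈ D'.gr n) : ∃ w ∈ D.gr n, f w = w' := by
  rwa [← h.2.1 n] at hw

theorem IsEquivalence.isGradedModule [GradingRestrictedVertexAlgebra V]
    (h : IsEquivalence D D' f) (hD : D.IsGradedModule) :
    D'.IsGradedModule := by
  have hθ : ∀ a w, D'.theta a (f w) = f (D.theta a w) := fun a w => (h.1 a w).symm
  have h0 : ∀ w, D'.L0 (f w) = f (D.L0 w) := fun w => (h.2.2.1 w).symm
  have h1 : ∀ w, D'.Lm1 (f w) = f (D.Lm1 w) := fun w => (h.2.2.2 w).symm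
  have hext : ∀ {A B : Module.End ℂ M'}, (∀ w, A (f w) = B (f w)) → A = B := fun hAB =>
    LinearMap.ext fun w' => by
      obtain ⟨w, rfl⟩ := f.surjective w'
      exact hAB w
  obtain ⟨B, hB⟩ := hD.L0_bounded
  have hL0 : ⨆ μ ∈ {μ : ℂ | B ≤ μ.re}, D'.L0.maxGenEigenspace μ = ⊤ :=
    iSup_maxGenEigenspace_of_iSup_range (ι := Unit) (A := fun _ => M) (f := fun _ => D.L0)
      (fun _ => f.toLinearMap) (fun _ w => h.2.2.1 w) (by simp)
      (fun _ => iSup_maxGenEigenspace_eq_top_of_mem hD.L0_graded fun μ hμ => hB μ (not_le.1 hμ))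
  have hgr : D'.gr = Submodule.orderIsoMapComap f ∘ D.gr := funext fun n => (h.2.1 n).symm
  refine
  { factors := ?_
    map_diamond := fun a b => hext fun w => ?_
    map_one := hext fun w => ?_
    isInternal := DirectSum.isInternal_submodule_of_iSupIndep_of_iSup_eq_top ?_ ?_
    gr_eq_bot := fun n hn => ?_
    elem_ne := fun k l n hk hl v hn w' hw' => ?_
    elem_mem := fun k l hk hl v w' hw' => ?_
    nondegenerate := fun l hl w' hw' hv => ?_
    L0_graded := top_le_iff.1 (hL0 ▸ iSup₂_le fun μ _ => le_iSup _ μ)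
    L0_bounded := ⟨B, fun μ hμ => maxGenEigenspace_eq_bot_of_notMem hL0 (not_le.2 hμ)⟩
    Lm1_mem := fun n hn w' hw' => ?_
    Lm1_top := fun w' hw' => ?_
    L0_Lm1 := hext fun w => ?_
    L0_elem := fun k l hk hl v => hext fun w => ?_
    Lm1_elem := fun k l hk hl v w' hw' => ?_ }
  · obtain ⟨θ, hθ'⟩ := hD.factors
    refine ⟨f.conj.toLinearMap ∘ₗ θ, fun a => hext fun w => ?_⟩
    rw [hθ, hθ']
    simp [LinearEquiv.conj_apply]
  · rw [hθ, hD.map_diamond, Module.End.mul_apply, Module.End.mul_apply, hθ, hθ]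
  · rw [hθ, hD.map_one, Module.End.one_apply, Module.End.one_apply]
  · rw [hgr]
    exact hD.isInternal.submodule_iSupIndep.map_orderIso _
  · rw [hgr]
    have := (Submodule.orderIsoMapComap f).map_iSup D.gr
    rw [hD.isInternal.submodule_iSup_eq_top, map_top] at this
    exact this.symm
  · rw [← h.2.1, hD.gr_eq_bot n hn, Submodule.map_bot]
  · obtain ⟨w, hw, rfl⟩ := h.exists_of_mem_gr hw'
    rw [hθ, hD.elem_ne k l n hk hl v hn w hw, map_zero]
  · obtain ⟨w, hw, rfl⟩ := h.exists_of_mem_gr hw'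
    rw [hθ]
    exact h.mem_gr (hD.elem_mem k l hk hl v w hw)
  · obtain ⟨w, hw, rfl⟩ := h.exists_of_mem_gr hw'
    rw [hD.nondegenerate l hl w hw fun v => f.injective ?_, map_zero]
    rw [← hθ, hv, map_zero]
  · obtain ⟨w, hw, rfl⟩ := h.exists_of_mem_gr hw'
    rw [h1]
    exact h.mem_gr (hD.Lm1_mem n hn w hw)
  · obtain ⟨w, hw, rfl⟩ := h.exists_of_mem_gr hw'
    rw [h1, hD.Lm1_top w hw, map_zero]
  · have := congrArg (fun A : Module.End ℂ M => f (A w)) hD.L0_Lm1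
    simpa [h0, h1] using this
  · have := congrArg (fun A : Module.End ℂ M => f (A w)) (hD.L0_elem k l hk hl v)
    simpa only [LinearMap.sub_apply, Module.End.mul_apply, map_sub, LinearMap.smul_apply, map_smul,
      h0, hθ] using this
  · obtain ⟨w, hw, rfl⟩ := h.exists_of_mem_gr hw'
    rw [hθ, h1, h1, hθ, hθ, ← map_sub, hD.Lm1_elem k l hk hl v w hw]

theorem IsEquivalence.isGradedSubmodule_map (h : IsEquivalence D D' f) {P : Submodule ℂ M}
    (hP : D.IsGradedSubmodule P) : D'.IsGradedSubmodule (P.map f.toLinearMap) where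
  theta_mem a := by
    rintro _ ⟨w, hw, rfl⟩
    exact ⟨_, hP.theta_mem a w hw, h.1 a w⟩
  graded := by
    conv_lhs => rw [hP.graded]
    rw [Submodule.map_iSup]
    refine iSup_congr fun n => ?_
    rw [← h.2.1, Submodule.map_inf _ f.injective]
  L0_mem := by
    rintro _ ⟨w, hw, rfl⟩
    exact ⟨_, hP.L0_mem w hw, h.2.2.1 w⟩
  Lm1_mem := by
    rintro _ ⟨w, hw, rfl⟩
    exact ⟨_, hP.Lm1_mem w hw, h.2.2.2 w⟩

theorem IsEquivalence.isIrreducibleSub_map (h : IsEquivalence D D' f) {P : Submodule ℂ M}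
    (hP : D.IsIrreducibleSub P) : D'.IsIrreducibleSub (P.map f.toLinearMap) := by
  refine ⟨h.isGradedSubmodule_map hP.1, fun h0 => hP.2.1 ?_, fun P' hP' hg => ?_⟩
  · exact Submodule.map_injective_of_injective (f := f.toLinearMap) f.injective
      (h0.trans (Submodule.map_bot _).symm)
  · have hid : (P'.map f.symm.toLinearMap).map f.toLinearMap = P' := by
      rw [← Submodule.map_comp]
      simp
    have hle : P'.map f.symm.toLinearMap ≤ P := by
      rintro _ ⟨w', hw', rfl⟩
      obtain ⟨w, hw, rfl⟩ := hP' hw'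
      simpa using hw
    rcases hP.2.2 _ hle (h.symm.isGradedSubmodule_map hg) with h0 | h0
    · left
      rw [← hid, h0, Submodule.map_bot]
    · right
      rw [← hid, h0]

theorem IsEquivalence.isIrreducible (h : IsEquivalence D D' f) (hD : D.IsIrreducible) :
    D'.IsIrreducible := by
  have := h.isIrreducibleSub_map hD
  rwa [Submodule.map_top, LinearEquiv.range] at this

theorem IsEquivalence.isCompletelyReducible (h : IsEquivalence D D' f)
    (hD : D.IsCompletelyReducible) : D'.IsCompletelyReducible := by
  obtain ⟨𝔇, h1, h2, h3⟩ := hD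
  have hr : Set.range (fun P : 𝔇 => (P : Submodule ℂ M).map f.toLinearMap) =
      (Submodule.map f.toLinearMap) '' 𝔇 := by
    ext; simp
  refine ⟨Submodule.map f.toLinearMap '' 𝔇, ?_, ?_, ?_⟩
  · rintro _ ⟨P, hP, rfl⟩
    exact h.isIrreducibleSub_map (h1 P hP)
  · rw [← hr]
    exact (((sSupIndep_iff _).1 h2).map_orderIso (Submodule.orderIsoMapComap f)).sSupIndep_range
  · have := (Submodule.orderIsoMapComap f).map_sSup 𝔇
    rw [h3, map_top] at this
    rw [sSup_image]
    exact this.symm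

end GradedData

/-! ### Degreewise isomorphisms and equivalences of truncations -/

section System

variable {V : Type u} [AddCommGroup V] [Module ℂ V]
variable {G G' : ℕ → Type u} [∀ n, AddCommGroup (G n)] [∀ n, Module ℂ (G n)]
  [∀ n, AddCommGroup (G' n)] [∀ n, Module ℂ (G' n)]
variable {act : ∀ k l : ℕ, V →ₗ[ℂ] G l →ₗ[ℂ] G k} {L0 : ∀ n, Module.End ℂ (G n)}
  {Lm1 : ∀ n, G n →ₗ[ℂ] G (n + 1)}
  {act' : ∀ k l : ℕ, V →ₗ[ℂ] G' l →ₗ[ℂ] G' k} {L0' : ∀ n, Module.End ℂ (G' n)}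
  {Lm1' : ∀ n, G' n →ₗ[ℂ] G' (n + 1)}

/-- A degreewise isomorphism of graded systems induces an equivalence of the truncations. -/
theorem exists_isEquivalence_truncData (N : ℕ) (e : ∀ n, G n ≃ₗ[ℂ] G' n)
    (hact : ∀ k l v x, e k (act k l v x) = act' k l v (e l x))
    (hL0 : ∀ n x, e n (L0 n x) = L0' n (e n x))
    (hLm1 : ∀ n x, e (n + 1) (Lm1 n x) = Lm1' n (e n x)) :
    ∃ f, GradedData.IsEquivalence (truncData N act L0 Lm1) (truncData N act' L0' Lm1') f := by
  let E : (⨁ n, G n) ≃ₗ[ℂ] ⨁ n, G' n := DFinsupp.mapRange.linearEquiv e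
  have hE : ∀ n x, E (DirectSum.lof ℂ ℕ G n x) = DirectSum.lof ℂ ℕ G' n (e n x) := fun n x =>
    DFinsupp.mapRange_single (hf := fun i => (e i).map_zero)
  have hr : ∀ n, (LinearMap.range (DirectSum.lof ℂ ℕ G n)).map E.toLinearMap =
      LinearMap.range (DirectSum.lof ℂ ℕ G' n) := by
    intro n
    rw [← LinearMap.range_comp]
    refine le_antisymm ?_ ?_
    · rintro _ ⟨x, rfl⟩
      exact ⟨e n x, (hE n x).symm⟩
    · rintro _ ⟨x, rfl⟩
      exact ⟨(e n).symm x, (hE n _).trans (by rw [LinearEquiv.apply_symm_apply])⟩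
  have hup : (upTo G N).map E.toLinearMap = upTo G' N := by
    rw [upTo.eq_1, upTo.eq_1, Submodule.map_iSup]
    exact iSup_congr fun n => hr n
  let f : upTo G N ≃ₗ[ℂ] upTo G' N := E.ofSubmodules _ _ hup
  have hf : ∀ n (hn : n ≤ N) x, f (lofUpTo G hn x) = lofUpTo G' hn (e n x) := fun n hn x =>
    Subtype.ext (hE n x)
  refine ⟨f, ?_, ?_, ?_, ?_⟩
  · intro a w
    refine Subtype.ext ?_
    show E (matAct act a.1 w.1) = matAct act' a.1 (E w.1)
    suffices E.toLinearMap ∘ₗ matAct act a.1 = matAct act' a.1 ∘ₗ E.toLinearMap from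
      LinearMap.congr_fun this w.1
    refine DirectSum.linearMap_ext _ fun l => LinearMap.ext fun x => ?_
    show E (matAct act a.1 (DirectSum.lof ℂ ℕ G l x)) =
      matAct act' a.1 (E (DirectSum.lof ℂ ℕ G l x))
    rw [hE, matAct_lof, matAct_lof, map_finsuppSum]
    exact Finsupp.sum_congr fun k _ => by rw [hE, hact]
  · intro n
    refine le_antisymm ?_ fun y hy => ?_
    · rintro _ ⟨x, hx, rfl⟩
      obtain ⟨z, hz⟩ := mem_truncData_gr.1 hx
      refine mem_truncData_gr.2 ⟨e n z, ?_⟩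
      rw [← hE, hz]
      rfl
    · obtain ⟨z, hz⟩ := mem_truncData_gr.1 hy
      refine ⟨f.symm y, mem_truncData_gr.2 ⟨(e n).symm z, E.injective ?_⟩, f.apply_symm_apply y⟩
      rw [hE, LinearEquiv.apply_symm_apply, hz]
      exact congrArg Subtype.val (f.apply_symm_apply y).symm
  · refine fun w => LinearMap.congr_fun (f := f.toLinearMap ∘ₗ (truncData N act L0 Lm1).L0)
      (g := (truncData N act' L0' Lm1').L0 ∘ₗ f.toLinearMap) (upTo_hom_ext fun n hn x => ?_) w
    show f ((truncData N act L0 Lm1).L0 _) = (truncData N act' L0' Lm1').L0 (f _)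
    rw [truncData_L0_lofUpTo, hf, hf, truncData_L0_lofUpTo, hL0]
  · refine fun w => LinearMap.congr_fun (f := f.toLinearMap ∘ₗ (truncData N act L0 Lm1).Lm1)
      (g := (truncData N act' L0' Lm1').Lm1 ∘ₗ f.toLinearMap) (upTo_hom_ext fun n hn x => ?_) w
    show f ((truncData N act L0 Lm1).Lm1 _) = (truncData N act' L0' Lm1').Lm1 (f _)
    rcases hn.lt_or_eq with h | rfl
    · rw [truncData_Lm1_lofUpTo h, hf, hf, truncData_Lm1_lofUpTo h, hLm1]
    · rw [hf, truncData_Lm1_lofUpTo_top, truncData_Lm1_lofUpTo_top, map_zero]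

end System

/-! ### Generated submodules and lowest weights -/

namespace LBGModule

variable {V : Type u} [AddCommGroup V] [Module ℂ V] [GradingRestrictedVertexAlgebra V]
variable {W : Type u} [AddCommGroup W] [Module ℂ W] (S : LBGModule V W)

theorem vmode_mem_of_opShift_mem {x : W} {Q : Submodule ℂ W} {f : Module.End ℂ W}
    (h : ∀ s v, f (S.opShift s v x) ∈ Q) (v : V) (k : ℤ) : f (vmode S.Y v k x) ∈ Q := by
  induction v using wt_induction with
  | h0 => simp [vmode_zero]
  | hadd a b ha hb =>
    rw [vmode_add, LinearMap.add_apply, map_add]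
    exact Q.add_mem ha hb
  | h d v hv =>
    have := h (d - 1 - k) v
    rwa [S.opShift_of_mem _ hv, sub_sub_cancel] at this

/-- A product of two modes applied to `w` is a combination of single modes applied to `w`. -/
theorem vmode_vmode_mem {Q : Submodule ℂ W} {w : W} (h : ∀ x j, vmode S.Y x j w ∈ Q)
    (u v : V) (p q : ℤ) : vmode S.Y u p (vmode S.Y v q w) ∈ Q := by
  obtain ⟨K, hK⟩ := exists_vmode_eq_zero S.Y u w
  obtain ⟨K', hK'⟩ := exists_vmode_eq_zero S.Y v w
  have key : ∀ (j : ℕ) (p q : ℤ), K' - q ≤ j → vmode S.Y u p (vmode S.Y v q w) ∈ Q := by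
    intro j
    induction j with
    | zero =>
      intro p q hq
      rw [hK' q (by push_cast at hq; omega), map_zero]
      exact Q.zero_mem
    | succ j ih =>
      -- With `u_{K+i} w = 0` for all `i`, the Jacobi identity expresses a combination of the
      -- `u_{p-i} v_{q+i} w` through single modes. The term `i = 0` is the one wanted, and the terms
      -- `i > 0` are closer to the bound `K'`, beyond which modes of `v` kill `w`.
      intro p q hq
      have hB := S.jacobi u v w K q (p - K)
      have hR : ∀ i : ℕ, vmode S.Y u (K + i) w = 0 := fun i => hK _ (by omega)
      simp only [hR, map_zero, smul_zero, sub_zero] at hB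
      have hfin : (Function.support fun i : ℕ => ((-1 : ℤ) ^ i * Ring.choose (p - K) i) •
          vmode S.Y u (K + (p - K) - i) (vmode S.Y v (q + i) w)).Finite := by
        refine (Set.finite_lt_nat (K' - q).toNat).subset fun i hi => ?_
        by_contra hlt
        refine hi ?_
        simp only [Set.mem_ofPred_eq, not_lt] at hlt
        show _ • _ = _
        rw [hK' _ (by omega), map_zero, smul_zero]
      have hmem : ∑ᶠ i : ℕ, ((-1 : ℤ) ^ i * Ring.choose (p - K) i) •
          vmode S.Y u (K + (p - K) - i) (vmode S.Y v (q + i) w) ∈ Q := by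
        rw [← hB]
        exact finsum_induction (· ∈ Q) Q.zero_mem (fun _ _ => Q.add_mem)
          fun i => zsmul_mem (h _ _) _
      rw [finsum_eq_sum_of_support_subset (s := insert 0 hfin.toFinset) _ (by simp),
        ← Finset.add_sum_erase _ _ (Finset.mem_insert_self 0 _)] at hmem
      have hrest : ∑ i ∈ (insert 0 hfin.toFinset).erase 0,
          ((-1 : ℤ) ^ i * Ring.choose (p - K) i) •
            vmode S.Y u (K + (p - K) - i) (vmode S.Y v (q + i) w) ∈ Q := by
        refine Q.sum_mem fun i hi => zsmul_mem (ih _ _ ?_) _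
        have : i ≠ 0 := Finset.ne_of_mem_erase hi
        push_cast at hq
        omega
      have h0 := (Q.add_mem_iff_left hrest).1 hmem
      simpa using h0
  exact key (K' - q).toNat p q (by omega)

/-- The span of the vectors `L(-1)^j v_k a` with `a ∈ A`. -/
def generated (A : Submodule ℂ W) : Submodule ℂ W :=
  Submodule.span ℂ {y | ∃ (j : ℕ) (v : V) (k : ℤ), ∃ a ∈ A, (S.Lm1 ^ j) (vmode S.Y v k a) = y}

theorem mem_generated {A : Submodule ℂ W} {a : W} (ha : a ∈ A) (j : ℕ) (v : V) (k : ℤ) :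
    (S.Lm1 ^ j) (vmode S.Y v k a) ∈ S.generated A :=
  Submodule.subset_span ⟨j, v, k, a, ha, rfl⟩

theorem le_generated (A : Submodule ℂ W) : A ≤ S.generated A := fun a ha => by
  simpa [S.identity] using S.mem_generated ha 0 vac (-1)

theorem Lm1_mem_generated {A : Submodule ℂ W} {x : W} (hx : x ∈ S.generated A) :
    S.Lm1 x ∈ S.generated A := by
  suffices S.generated A ≤ (S.generated A).comap S.Lm1 from this hx
  refine Submodule.span_le.2 ?_
  rintro _ ⟨j, v, k, a, ha, rfl⟩
  have := S.mem_generated ha (j + 1) v k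
  rwa [pow_succ', Module.End.mul_apply] at this

/-- A mode is moved past `L(-1)` at the cost of a mode of `L_V(-1)u`, so the induction on `j` has to
allow every `u`. Keeping the powers of `L(-1)` to the left of a single mode is what later controls
the degrees of intermediate vectors. -/
theorem vmode_mem_generated {A : Submodule ℂ W} {a : W} (ha : a ∈ A) (v : V) (k : ℤ) (j : ℕ) :
    ∀ (u : V) (p : ℤ), vmode S.Y u p ((S.Lm1 ^ j) (vmode S.Y v k a)) ∈ S.generated A := by
  induction j with
  | zero =>
    intro u p
    exact S.vmode_vmode_mem (fun x j => S.mem_generated ha 0 x j) u v p k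
  | succ j ih =>
    intro u p
    rw [pow_succ', Module.End.mul_apply]
    have h := congrArg (fun f : Module.End ℂ W => f ((S.Lm1 ^ j) (vmode S.Y v k a)))
      (S.Lm1_bracket u p)
    simp only [LinearMap.sub_apply, Module.End.mul_apply] at h
    rw [← sub_sub_self (S.Lm1 _) (vmode S.Y u p _), h]
    exact Submodule.sub_mem _ (S.Lm1_mem_generated (ih u p)) (ih _ p)

theorem L0_mem_generated {A : Submodule ℂ W} (hA : ∀ a ∈ A, S.L0 a ∈ A) {a : W} (ha : a ∈ A)
    (v : V) (k : ℤ) (j : ℕ) : S.L0 ((S.Lm1 ^ j) (vmode S.Y v k a)) ∈ S.generated A := by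
  induction j with
  | zero =>
    have h := congrArg (fun f : Module.End ℂ W => f a) (S.L0_bracket v k)
    simp only [LinearMap.sub_apply, Module.End.mul_apply, LinearMap.smul_apply] at h
    rw [pow_zero, Module.End.one_apply, ← sub_add_cancel (S.L0 _) (vmode S.Y v k (S.L0 a)), h]
    exact Submodule.add_mem _ (Submodule.sub_mem _ (S.mem_generated ha 0 _ k)
      (Submodule.smul_mem _ _ (S.mem_generated ha 0 v k))) (S.mem_generated (hA a ha) 0 v k)
  | succ j ih =>
    rw [pow_succ', Module.End.mul_apply]
    have h := congrArg (fun f : Module.End ℂ W => f ((S.Lm1 ^ j) (vmode S.Y v k a))) S.L0_Lm1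
    simp only [LinearMap.sub_apply, Module.End.mul_apply] at h
    rw [← sub_add_cancel (S.L0 _) (S.Lm1 (S.L0 _)), h]
    exact Submodule.add_mem _ (S.Lm1_mem_generated (S.mem_generated ha j v k))
      (S.Lm1_mem_generated ih)

theorem generated_isSubmodule {A : Submodule ℂ W} (hA : ∀ a ∈ A, S.L0 a ∈ A) :
    S.IsSubmodule (S.generated A) where
  mode_mem u p := by
    suffices S.generated A ≤ (S.generated A).comap (vmode S.Y u p) from this
    refine Submodule.span_le.2 ?_
    rintro _ ⟨j, v, k, a, ha, rfl⟩
    exact S.vmode_mem_generated ha v k j u p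
  L0_mem := by
    suffices S.generated A ≤ (S.generated A).comap S.L0 from this
    refine Submodule.span_le.2 ?_
    rintro _ ⟨j, v, k, a, ha, rfl⟩
    exact S.L0_mem_generated hA ha v k j
  Lm1_mem _ hx := S.Lm1_mem_generated hx

theorem generated_le {A Q : Submodule ℂ W}
    (h : ∀ a ∈ A, ∀ (j : ℕ) (s : ℤ) (v : V), (S.Lm1 ^ j) (S.opShift s v a) ∈ Q) :
    S.generated A ≤ Q := by
  refine Submodule.span_le.2 ?_
  rintro _ ⟨j, v, k, a, ha, rfl⟩
  exact S.vmode_mem_of_opShift_mem (h a ha j) v k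

theorem Lm1_pow_mem {P : Submodule ℂ W} (hP : S.IsSubmodule P) {x : W} (hx : x ∈ P) (j : ℕ) :
    (S.Lm1 ^ j) x ∈ P := by
  induction j with
  | zero => simpa using hx
  | succ j ih =>
    rw [pow_succ', Module.End.mul_apply]
    exact hP.Lm1_mem _ ih

/-- This is the only way irreducibility enters the two main arguments: for a part of `Ω_n` in a
single weight, and for the degree-zero part of a graded submodule. -/
theorem generated_eq_of_isIrreducibleSub {P A : Submodule ℂ W} (hP : S.IsIrreducibleSub P)
    (hAP : A ≤ P) (hA : ∀ a ∈ A, S.L0 a ∈ A) (hne : A ≠ ⊥) : S.generated A = P := by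
  refine (hP.2.2 _ (S.generated_le fun a ha j s v => ?_) (S.generated_isSubmodule hA)).resolve_left
    fun h0 => hne (le_bot_iff.1 (h0 ▸ S.le_generated A))
  exact S.Lm1_pow_mem hP.1 (S.opShift_mem_sub s v P hP.1 a (hAP ha)) j

theorem Lm1_pow_mem_maxGenEigenspace {μ : ℂ} {x : W} (hx : x ∈ S.L0.maxGenEigenspace μ) (j : ℕ) :
    (S.Lm1 ^ j) x ∈ S.L0.maxGenEigenspace (μ + j) := by
  induction j with
  | zero => simpa using hx
  | succ j ih =>
    rw [pow_succ', Module.End.mul_apply, Nat.cast_succ, ← add_assoc]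
    exact S.maxGen_shift (s := 1) (by simpa using S.L0_Lm1) _ _ ih

theorem opShift_mem_maxGenEigenspace {μ : ℂ} {x : W} (hx : x ∈ S.L0.maxGenEigenspace μ) (s : ℤ)
    (v : V) : S.opShift s v x ∈ S.L0.maxGenEigenspace (μ + s) :=
  S.maxGen_shift (S.opShift_bracket s v) _ _ hx

theorem mem_of_inf_maxGenEigenspace_ne_bot {P : Submodule ℂ W} {s : Set ℂ}
    (h : P ≤ ⨆ μ ∈ s, S.L0.maxGenEigenspace μ) {ν : ℂ} (hν : P ⊓ S.L0.maxGenEigenspace ν ≠ ⊥) :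
    ν ∈ s := by
  by_contra hs
  refine hν (le_bot_iff.1 ?_)
  have h1 := S.L0.independent_maxGenEigenspace.disjoint_biSup hs
  exact le_trans (le_inf inf_le_right (inf_le_left.trans h)) h1.eq_bot.le

variable {S}

theorem IsLowestWeight.le_biSup {P : Submodule ℂ W} {h : ℂ} (hP : S.IsLowestWeight P h) :
    P ≤ ⨆ μ ∈ Set.range (fun n : ℕ => h + n), S.L0.maxGenEigenspace μ := by
  conv_lhs => rw [hP.2.1]
  exact iSup_le fun n => inf_le_right.trans
    (le_iSup₂_of_le (f := fun μ _ => S.L0.maxGenEigenspace μ) _ ⟨n, rfl⟩ le_rfl)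

/-- Each of the two weights is the other plus a natural number. -/
theorem IsLowestWeight.unique {P : Submodule ℂ W} {h h' : ℂ} (hP : S.IsLowestWeight P h)
    (hP' : S.IsLowestWeight P h') : h = h' := by
  obtain ⟨n, hn⟩ := S.mem_of_inf_maxGenEigenspace_ne_bot hP'.le_biSup hP.2.2
  obtain ⟨m, hm⟩ := S.mem_of_inf_maxGenEigenspace_ne_bot hP.le_biSup hP'.2.2
  simp only at hn hm
  have h1 : ((n + m : ℕ) : ℂ) = 0 := by
    push_cast
    linear_combination hn + hm
  have h2 : n = 0 := by
    have := Nat.cast_eq_zero.1 h1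
    omega
  rw [← hn, h2]
  simp

theorem IsLowestWeight.inf_eq_bot {P : Submodule ℂ W} {h : ℂ} (hP : S.IsLowestWeight P h) {s : ℤ}
    (hs : s < 0) : P ⊓ S.L0.maxGenEigenspace (h + s) = ⊥ := by
  by_contra hne
  obtain ⟨n, hn⟩ := S.mem_of_inf_maxGenEigenspace_ne_bot hP.le_biSup hne
  have h1 : ((n : ℤ) : ℂ) = s := by
    push_cast
    exact add_left_cancel hn
  have := Int.cast_injective h1
  omega

theorem IsLowestWeight.inf_le_Omega {P : Submodule ℂ W} {h : ℂ} (hP : S.IsLowestWeight P h)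
    (n : ℕ) : P ⊓ S.L0.maxGenEigenspace (h + n) ≤ S.Omega n := by
  rintro w ⟨hw, hw'⟩ d k v hv hk
  have h1 : vmode S.Y v k w ∈ P ⊓ S.L0.maxGenEigenspace (h + ((n + (d - 1 - k) : ℤ) : ℂ)) := by
    refine ⟨hP.1.mode_mem v k w hw, ?_⟩
    have h2 := S.opShift_mem_maxGenEigenspace hw' (d - 1 - k) v
    rw [S.opShift_of_mem _ hv, sub_sub_cancel, add_assoc] at h2
    push_cast at h2 ⊢
    exact h2
  rw [hP.inf_eq_bot (by omega)] at h1
  exact h1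

/-- If nonzero, this `L(0)`-stable subspace generates `P`. Modes of weight below `-n` kill it, so
the generators that survive have weights `h + m + s + j` with `s ≥ -n` and `j ≥ 0`. None of these
equals `h`, since `m > n`, although `P_[h] ≠ 0`. -/
theorem IsIrreducibleSub.inf_Omega_eq_bot {P : Submodule ℂ W} (hirr : S.IsIrreducibleSub P)
    {h : ℂ} (hP : S.IsLowestWeight P h) {n : ℤ} {m : ℕ} (hnm : n < m) :
    P ⊓ S.L0.maxGenEigenspace (h + m) ⊓ S.Omega n = ⊥ := by
  by_contra hne
  have hgen := S.generated_eq_of_isIrreducibleSub hirr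
    (A := P ⊓ S.L0.maxGenEigenspace (h + m) ⊓ S.Omega n) (inf_le_left.trans inf_le_left)
    (fun a ha => ⟨⟨hP.1.L0_mem a ha.1.1, S.L0.mapsTo_maxGenEigenspace_of_comm rfl _ ha.1.2⟩,
      by simpa using S.L0_mem_Omega n a ha.2⟩) hne
  have hle : P ≤ ⨆ μ ∈ {μ : ℂ | μ ≠ h}, S.L0.maxGenEigenspace μ := by
    rw [← hgen]
    refine S.generated_le fun a ha j s v => ?_
    by_cases hs : s < -n
    · rw [S.opShift_eq_zero_of_mem_Omega hs ha.2, map_zero]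
      exact Submodule.zero_mem _
    · have h1 := S.Lm1_pow_mem_maxGenEigenspace (S.opShift_mem_maxGenEigenspace ha.1.2 s v) j
      refine Submodule.mem_iSup_of_mem _ (Submodule.mem_iSup_of_mem ?_ h1)
      intro h2
      have h3 : ((m + s + j : ℤ) : ℂ) = ((0 : ℤ) : ℂ) := by
        push_cast
        linear_combination h2
      have := Int.cast_injective h3
      omega
  exact S.mem_of_inf_maxGenEigenspace_ne_bot hle hP.2.2 rfl

theorem isSubmodule_iSup_int {P : Submodule ℂ W} (hP : S.IsSubmodule P) (μ : ℂ) :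
    S.IsSubmodule (⨆ n : ℤ, P ⊓ S.L0.maxGenEigenspace (μ + n)) := by
  have key : ∀ (f : Module.End ℂ W) (s : ℤ), S.L0 * f - f * S.L0 = (s : ℂ) • f →
      (∀ w ∈ P, f w ∈ P) → ∀ w ∈ ⨆ n : ℤ, P ⊓ S.L0.maxGenEigenspace (μ + n),
        f w ∈ ⨆ n : ℤ, P ⊓ S.L0.maxGenEigenspace (μ + n) := by
    intro f s hf hfP
    suffices (⨆ n : ℤ, P ⊓ S.L0.maxGenEigenspace (μ + n)) ≤
      (⨆ n : ℤ, P ⊓ S.L0.maxGenEigenspace (μ + n)).comap f from this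
    refine iSup_le fun n w hw => Submodule.mem_iSup_of_mem (n + s) ⟨hfP w hw.1, ?_⟩
    have := S.maxGen_shift hf _ w hw.2
    rwa [add_assoc, ← Int.cast_add] at this
  refine ⟨fun v k w hw => ?_, key S.L0 0 (by simp) hP.L0_mem,
    key S.Lm1 1 (by simpa using S.L0_Lm1) hP.Lm1_mem⟩
  exact S.vmode_mem_of_opShift_mem (f := 1) (fun s v => key _ s (S.opShift_bracket s v)
    (S.opShift_mem_sub s v P hP) w hw) v k

/-- The weights of `P` in one coset of `ℤ` span a submodule, so by irreducibility a single coset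
occurs; boundedness then provides a least weight in it. -/
theorem IsIrreducibleSub.exists_isLowestWeight {P : Submodule ℂ W} (hP : S.IsIrreducibleSub P) :
    ∃ h, S.IsLowestWeight P h := by
  have h1 := le_iSup_inf_maxGenEigenspace (p := P) hP.1.L0_mem Set.univ (by simp [S.graded])
  obtain ⟨μ, hμ⟩ : ∃ μ, P ⊓ S.L0.maxGenEigenspace μ ≠ ⊥ := by
    by_contra! hall
    refine hP.2.1 (le_bot_iff.1 (h1.trans ?_))
    simp [hall]
  have hQ : (⨆ n : ℤ, P ⊓ S.L0.maxGenEigenspace (μ + n)) = P := by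
    refine (hP.2.2 _ (iSup_le fun _ => inf_le_left) (isSubmodule_iSup_int hP.1 μ)).resolve_left ?_
    intro h0
    rw [iSup_eq_bot] at h0
    exact hμ (by simpa using h0 0)
  obtain ⟨B, hB⟩ := S.bounded
  obtain ⟨n₀, hn₀, hmin⟩ := Int.exists_least_of_bdd
    (P := fun n : ℤ => P ⊓ S.L0.maxGenEigenspace (μ + n) ≠ ⊥)
    -- For smaller `n` the real part of `μ + n` is below `B`, where the generalized eigenspaces
    -- vanish.
    ⟨⌊B - μ.re⌋, fun n hn => by
      by_contra hlt
      refine hn (le_bot_iff.1 (inf_le_right.trans (hB _ ?_).le))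
      have h2 : (n : ℝ) < ⌊B - μ.re⌋ := Int.cast_lt.2 (not_le.1 hlt)
      have h3 := Int.floor_le (B - μ.re)
      simp only [Complex.add_re, Complex.intCast_re]
      linarith⟩ ⟨0, by simpa using hμ⟩
  refine ⟨μ + n₀, hP.1, le_antisymm ?_ (iSup_le fun _ => inf_le_left), hn₀⟩
  conv_lhs => rw [← hQ]
  refine iSup_le fun n => ?_
  by_cases hn : P ⊓ S.L0.maxGenEigenspace (μ + n) = ⊥
  · rw [hn]
    exact bot_le
  · obtain ⟨m, rfl⟩ := Int.le.dest (hmin n hn)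
    refine le_iSup_of_le m (le_of_eq ?_)
    push_cast
    rw [add_assoc]

end LBGModule

/-! ### Decompositions into irreducible submodules -/

namespace LBGModule

variable {V : Type u} [AddCommGroup V] [Module ℂ V] [GradingRestrictedVertexAlgebra V]
variable {W : Type u} [AddCommGroup W] [Module ℂ W] {S : LBGModule V W}
variable {𝔇 : Set (Submodule ℂ W)}

namespace IsDecomposition

variable (h𝔇 : S.IsDecomposition 𝔇)
include h𝔇

theorem isInternal [DecidableEq 𝔇] : DirectSum.IsInternal (fun P : 𝔇 => (P : Submodule ℂ W)) :=
  DirectSum.isInternal_submodule_of_iSupIndep_of_iSup_eq_top ((sSupIndep_iff _).1 h𝔇.2.1)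
    (by rw [← sSup_eq_iSup', h𝔇.2.2])

theorem hom_ext {Z : Type*} [AddCommGroup Z] [Module ℂ Z] {f g : W →ₗ[ℂ] Z}
    (h : ∀ P ∈ 𝔇, ∀ x ∈ P, f x = g x) : f = g := by
  rw [← LinearMap.eqLocus_eq_top, ← top_le_iff, ← h𝔇.2.2]
  exact sSup_le fun P hP x hx => h P hP x hx

/-- Linear maps on the summands of a decomposition glue to a linear map on the whole space. -/
theorem exists_glue {Z : Type*} [AddCommGroup Z] [Module ℂ Z]
    (f : ∀ P : 𝔇, (P : Submodule ℂ W) →ₗ[ℂ] Z) :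
    ∃ T : W →ₗ[ℂ] Z, ∀ (P : 𝔇) (x : (P : Submodule ℂ W)), T x = f P x := by
  classical
  let E := LinearEquiv.ofBijective (DirectSum.coeLinearMap fun P : 𝔇 => (P : Submodule ℂ W))
    h𝔇.isInternal
  refine ⟨DirectSum.toModule ℂ 𝔇 Z f ∘ₗ E.symm.toLinearMap, fun P x => ?_⟩
  have : E.symm (x : W) = DirectSum.lof ℂ 𝔇 (fun P => (P : Submodule ℂ W)) P x := by
    rw [LinearEquiv.symm_apply_eq]
    exact (DirectSum.coeLinearMap_lof (fun P : 𝔇 => (P : Submodule ℂ W)) P x).symm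
  simp [this]

/-- The projections of a decomposition. -/
theorem exists_proj : ∃ π : 𝔇 → Module.End ℂ W,
    (∀ (P : 𝔇), ∀ x ∈ P.1, π P x = x) ∧ (∀ (P : 𝔇) x, π P x ∈ P.1) ∧
    (∀ P : 𝔇, ∀ f : Module.End ℂ W, (∀ Q ∈ 𝔇, ∀ x ∈ Q, f x ∈ Q) → ∀ x, π P (f x) = f (π P x)) ∧
    ∀ x, (∀ P, π P x = 0) → x = 0 := by
  classical
  choose π hπ using fun P : 𝔇 => h𝔇.exists_glue
    (fun Q : 𝔇 => if Q = P then (Q : Submodule ℂ W).subtype else 0)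
  have h1 : ∀ (P : 𝔇), ∀ x ∈ P.1, π P x = x := fun P x hx => by
    simpa using hπ P P ⟨x, hx⟩
  have h2 : ∀ (P Q : 𝔇), Q ≠ P → ∀ x ∈ Q.1, π P x = 0 := fun P Q hne x hx => by
    simpa [hne] using hπ P Q ⟨x, hx⟩
  refine ⟨π, h1, fun P x => ?_, fun P f hf x => ?_, fun x hx => ?_⟩
  · suffices (⊤ : Submodule ℂ W) ≤ P.1.comap (π P) from this trivial
    rw [← h𝔇.2.2]
    refine sSup_le fun Q hQ y hy => ?_
    rw [Submodule.mem_comap]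
    by_cases hQP : (⟨Q, hQ⟩ : 𝔇) = P
    · subst hQP
      rwa [h1 _ y hy]
    · rw [h2 P ⟨Q, hQ⟩ hQP y hy]
      exact P.1.zero_mem
  · suffices π P ∘ₗ f = f ∘ₗ π P from LinearMap.congr_fun this x
    refine h𝔇.hom_ext fun Q hQ y hy => ?_
    rw [LinearMap.comp_apply, LinearMap.comp_apply]
    by_cases hQP : (⟨Q, hQ⟩ : 𝔇) = P
    · subst hQP
      rw [h1 _ y hy, h1 _ _ (hf Q hQ y hy)]
    · rw [h2 P ⟨Q, hQ⟩ hQP y hy, h2 P ⟨Q, hQ⟩ hQP _ (hf Q hQ y hy), map_zero]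
  · have hx' : x ∈ ⨆ P : 𝔇, P.1 := by
      rw [← sSup_eq_iSup', h𝔇.2.2]
      trivial
    obtain ⟨y, hy, hsum⟩ := (Submodule.mem_iSup_iff_exists_finsupp _ _).1 hx'
    rw [← hsum, Finsupp.sum]
    refine Finset.sum_eq_zero fun P hP => ?_
    rw [← hx P, ← hsum, Finsupp.sum, map_sum, Finset.sum_eq_single P, h1 P _ (hy P)]
    · exact fun Q _ hQ => h2 P Q hQ _ (hy Q)
    · exact fun h => absurd hP h

theorem isSubmodule {P : Submodule ℂ W} (hP : P ∈ 𝔇) : S.IsSubmodule P := (h𝔇.1 P hP).1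

theorem exists_lowestWeights : ∃ h : 𝔇 → ℂ, ∀ P : 𝔇, S.IsLowestWeight P.1 (h P) := by
  choose h hh using fun P : 𝔇 => (h𝔇.1 P.1 P.2).exists_isLowestWeight
  exact ⟨h, hh⟩

omit h𝔇 in
theorem GSub_eq_iSup {h : 𝔇 → ℂ} (hh : ∀ P : 𝔇, S.IsLowestWeight P.1 (h P)) (n : ℕ) :
    S.GSub 𝔇 n = ⨆ P : 𝔇, P.1 ⊓ S.L0.maxGenEigenspace (h P + n) := by
  refine le_antisymm (iSup₂_le fun P hP => iSup₂_le fun μ hμ => ?_) (iSup_le fun P => ?_)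
  · rw [hμ.unique (hh ⟨P, hP⟩)]
    exact le_iSup (fun P : 𝔇 => P.1 ⊓ S.L0.maxGenEigenspace (h P + n)) ⟨P, hP⟩
  · exact le_iSup₂_of_le P.1 P.2 (le_iSup₂_of_le (h P) (hh P) le_rfl)

/-- There is an operator whose generalized eigenspace with eigenvalue `n` is `G_n(W)`, and which
satisfies the same bracket relations with modes as `L_W(0)`. -/
theorem exists_degree_operator : ∃ T : Module.End ℂ W,
    (∀ P ∈ 𝔇, ∀ x ∈ P, T x ∈ P) ∧ (∀ (n : ℤ), ∀ w ∈ S.Omega n, T w ∈ S.Omega n) ∧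
    (∀ P ∈ 𝔇, ∀ h, S.IsLowestWeight P h → ∀ x ∈ P, ∀ μ,
      x ∈ T.maxGenEigenspace μ ↔ x ∈ S.L0.maxGenEigenspace (h + μ)) := by
  obtain ⟨h, hh⟩ := h𝔇.exists_lowestWeights
  -- Subtracting `h_P` on each `P` puts all lowest weight spaces in degree `0`, although the weights
  -- `h_P` may be unrelated.
  obtain ⟨T, hT⟩ := h𝔇.exists_glue (fun P : 𝔇 => (S.L0 - h P • 1) ∘ₗ P.1.subtype)
  have hT' : ∀ (P : 𝔇), ∀ x ∈ P.1, T x = S.L0 x - h P • x := fun P x hx => hT P ⟨x, hx⟩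
  have hTP : ∀ P ∈ 𝔇, ∀ x ∈ P, T x ∈ P := fun P hP x hx => by
    rw [hT' ⟨P, hP⟩ x hx]
    exact P.sub_mem ((h𝔇.isSubmodule hP).L0_mem x hx) (P.smul_mem _ hx)
  refine ⟨T, hTP, fun n w hw d k v hv hk => ?_, fun P hP h' hh' x hx μ => ?_⟩
  -- Modes preserve each `P`, so the scalar `h_P` drops out of the commutator; hence `T` preserves
  -- `Ω_n` for the same reason as `L(0)`.
  · have hbr : T * vmode S.Y v k - vmode S.Y v k * T = S.L0 * vmode S.Y v k - vmode S.Y v k * S.L0 := by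
      refine h𝔇.hom_ext fun P hP x hx => ?_
      simp only [LinearMap.sub_apply, Module.End.mul_apply]
      rw [hT' ⟨P, hP⟩ x hx, hT' ⟨P, hP⟩ _ ((h𝔇.isSubmodule hP).mode_mem v k x hx), map_sub,
        map_smul]
      abel
    have h1 := congrArg (fun f : Module.End ℂ W => f w) hbr
    have h2 := S.L0_mem_Omega n w hw d k v hv (by omega)
    simpa [hw d k v hv hk, h2] using h1
  · obtain rfl := hh'.unique (hh ⟨P, hP⟩)
    have hpow : ∀ (k : ℕ), ((T - μ • 1) ^ k) x = ((S.L0 - (h ⟨P, hP⟩ + μ) • 1) ^ k) x ∧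
        ((T - μ • 1) ^ k) x ∈ P := by
      intro k
      induction k with
      | zero => exact ⟨rfl, by simpa using hx⟩
      | succ k ih =>
        rw [pow_succ', pow_succ', Module.End.mul_apply, Module.End.mul_apply, ← ih.1]
        refine ⟨?_, ?_⟩
        · simp only [LinearMap.sub_apply, LinearMap.smul_apply, Module.End.one_apply]
          rw [hT' ⟨P, hP⟩ _ ih.2, add_smul]
          abel
        · exact P.sub_mem (hTP P hP _ ih.2) (P.smul_mem _ ih.2)
    rw [Module.End.mem_maxGenEigenspace, Module.End.mem_maxGenEigenspace]
    exact exists_congr fun k => by rw [(hpow k).1]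

theorem iSup_GSub : ⨆ n, S.GSub 𝔇 n = ⊤ := by
  obtain ⟨h, hh⟩ := h𝔇.exists_lowestWeights
  rw [← top_le_iff, ← h𝔇.2.2]
  refine sSup_le fun P hP => ?_
  conv_lhs => rw [show P = _ from (hh ⟨P, hP⟩).2.1]
  refine iSup_mono fun n => ?_
  rw [GSub_eq_iSup hh]
  exact le_iSup (fun P : 𝔇 => P.1 ⊓ S.L0.maxGenEigenspace (h P + n)) ⟨P, hP⟩

theorem exists_degree_operator_GSub : ∃ T : Module.End ℂ W,
    (∀ P ∈ 𝔇, ∀ x ∈ P, T x ∈ P) ∧ (∀ (n : ℤ), ∀ w ∈ S.Omega n, T w ∈ S.Omega n) ∧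
    (∀ P ∈ 𝔇, ∀ h, S.IsLowestWeight P h → ∀ x ∈ P, ∀ μ,
      x ∈ T.maxGenEigenspace μ ↔ x ∈ S.L0.maxGenEigenspace (h + μ)) ∧
    ∀ n : ℕ, S.GSub 𝔇 n = T.maxGenEigenspace n := by
  obtain ⟨T, hT1, hT2, hT3⟩ := h𝔇.exists_degree_operator
  obtain ⟨h, hh⟩ := h𝔇.exists_lowestWeights
  have hle : ∀ n : ℕ, S.GSub 𝔇 n ≤ T.maxGenEigenspace n := fun n => by
    rw [GSub_eq_iSup hh]
    exact iSup_le fun P x hx => (hT3 P.1 P.2 (h P) (hh P) x hx.1 n).2 hx.2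
  refine ⟨T, hT1, hT2, hT3, fun n => le_antisymm (hle n) ?_⟩
  have hind : iSupIndep fun n : ℕ => T.maxGenEigenspace n :=
    T.independent_maxGenEigenspace.comp Nat.cast_injective
  have hdis := (hind n).mono_right (iSup₂_mono fun m (_ : m ≠ n) => hle m)
  have htop : S.GSub 𝔇 n ⊔ ⨆ (m : ℕ) (_ : m ≠ n), S.GSub 𝔇 m = ⊤ := by
    rw [← top_le_iff, ← h𝔇.iSup_GSub]
    refine iSup_le fun m => ?_
    by_cases hm : m = n
    · exact hm ▸ le_sup_left
    · exact le_sup_of_le_right (le_iSup₂_of_le m hm le_rfl)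
  -- By the modular law: `G_n` and the other `G_m` span `W`, and the sum of the other `G_m` meets
  -- the eigenspace of `n` trivially, so `G_n` fills that eigenspace.
  have := sup_inf_assoc_of_le (⨆ (m : ℕ) (_ : m ≠ n), S.GSub 𝔇 m) (hle n)
  rw [htop, top_inf_eq, inf_comm, hdis.eq_bot, sup_bot_eq] at this
  exact this.le

theorem isInternal_GSub : DirectSum.IsInternal (S.GSub 𝔇) := by
  obtain ⟨T, -, -, -, hT⟩ := h𝔇.exists_degree_operator_GSub
  refine DirectSum.isInternal_submodule_of_iSupIndep_of_iSup_eq_top ?_ h𝔇.iSup_GSub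
  rw [show S.GSub 𝔇 = fun n : ℕ => T.maxGenEigenspace n from funext hT]
  exact T.independent_maxGenEigenspace.comp Nat.cast_injective

theorem GSub_le_Omega (n : ℕ) : S.GSub 𝔇 n ≤ S.Omega n := by
  obtain ⟨h, hh⟩ := h𝔇.exists_lowestWeights
  rw [GSub_eq_iSup hh]
  exact iSup_le fun P => (hh P).inf_le_Omega n

/-- The projection to a summand commutes with all modes, hence preserves `Ω_n`, and with the degree
operator, hence preserves degree `m`. This reduces the claim to a single irreducible summand. -/
theorem GSub_inf_Omega {n : ℤ} {m : ℕ} (hnm : n < m) : S.GSub 𝔇 m ⊓ S.Omega n = ⊥ := by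
  obtain ⟨T, hT1, -, hT3, hT4⟩ := h𝔇.exists_degree_operator_GSub
  obtain ⟨h, hh⟩ := h𝔇.exists_lowestWeights
  obtain ⟨π, -, hπ2, hπ3, hπ4⟩ := h𝔇.exists_proj
  rw [Submodule.eq_bot_iff]
  rintro w ⟨hw1, hw2⟩
  refine hπ4 w fun P => ?_
  have h1 : π P w ∈ S.Omega n := fun d k v hv hk => by
    rw [← hπ3 P _ (fun Q hQ => (h𝔇.isSubmodule hQ).mode_mem v k), hw2 d k v hv hk, map_zero]
  rw [SetLike.mem_coe, hT4] at hw1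
  have h2 := map_mem_maxGenEigenspace (g := T) (π P) (hπ3 P T hT1) hw1
  rw [hT3 P.1 P.2 (h P) (hh P) _ (hπ2 P w)] at h2
  have h3 : π P w ∈ P.1 ⊓ S.L0.maxGenEigenspace (h P + m) ⊓ S.Omega n := ⟨⟨hπ2 P w, h2⟩, h1⟩
  rwa [(h𝔇.1 P.1 P.2).inf_Omega_eq_bot (hh P) hnm] at h3

/-- `Ω_n` is stable under the degree operator, so it is the sum of its homogeneous parts. Those of
degree `m < n` lie in `Ω_m ⊆ Ω_{n-1}`, and those of degree `m > n` vanish. -/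
theorem Omega_le (n : ℕ) : S.Omega n ≤ S.GSub 𝔇 n ⊔ S.Omega ((n : ℤ) - 1) := by
  obtain ⟨T, -, hT2, -, hT4⟩ := h𝔇.exists_degree_operator_GSub
  have h1 := le_iSup_inf_maxGenEigenspace (hT2 n) (Set.range ((↑) : ℕ → ℂ)) (by
    rw [iSup_range]
    simp_rw [← hT4, h𝔇.iSup_GSub]
    exact le_top)
  rw [iSup_range] at h1
  refine h1.trans (iSup_le fun m => ?_)
  rw [← hT4]
  rcases lt_trichotomy m n with hm | rfl | hm
  · exact le_sup_of_le_right (inf_le_right.trans ((h𝔇.GSub_le_Omega m).trans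
      (S.Omega_mono (by omega))))
  · exact le_sup_of_le_left inf_le_right
  · rw [inf_comm, h𝔇.GSub_inf_Omega (by exact_mod_cast hm)]
    exact bot_le

/-- The canonical map `G_n(W) → Gr_n(W)`. -/
noncomputable def toGr (n : ℕ) : S.GSub 𝔇 n →ₗ[ℂ] S.Gr n :=
  Submodule.mkQ _ ∘ₗ Submodule.inclusion (h𝔇.GSub_le_Omega n)

theorem toGr_bijective (n : ℕ) : Function.Bijective (h𝔇.toGr n) := by
  refine ⟨(injective_iff_map_eq_zero _).2 fun x hx => ?_, fun y => ?_⟩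
  · have h1 : (x : W) ∈ S.GSub 𝔇 n ⊓ S.Omega ((n : ℤ) - 1) := ⟨x.2, S.Gr_mk_eq_zero.1 hx⟩
    rw [h𝔇.GSub_inf_Omega (by omega)] at h1
    exact Subtype.ext h1
  · obtain ⟨y, rfl⟩ := Submodule.Quotient.mk_surjective _ y
    obtain ⟨g, hg, o, ho, hgo⟩ := Submodule.mem_sup.1 (h𝔇.Omega_le n y.2)
    refine ⟨⟨g, hg⟩, (Submodule.Quotient.eq _).2 ?_⟩
    show g - (y : W) ∈ S.Omega ((n : ℤ) - 1)
    rw [← hgo, sub_add_cancel_left]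
    exact Submodule.neg_mem _ ho

theorem exists_isEquivalence (N : ℕ) :
    ∃ f, GradedData.IsEquivalence (S.GrN N) (S.TN 𝔇 N) f := by
  obtain ⟨f, hf⟩ := exists_isEquivalence_truncData N (act := S.GSubAct 𝔇)
    (L0 := fun n => S.L0.restrict (S.L0_mem_GSub 𝔇 n))
    (Lm1 := fun n => S.Lm1.restrict (S.Lm1_mem_GSub 𝔇 n)) (act' := S.grAct) (L0' := S.grL0)
    (Lm1' := S.grLm1) (fun n => LinearEquiv.ofBijective (h𝔇.toGr n) (h𝔇.toGr_bijective n))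
    (fun k l v x => rfl) (fun n x => rfl) (fun n x => rfl)
  exact ⟨f.symm, hf.symm⟩

/-- The structure is transported from `Gr^N(W)`: `Q^∞(V)` is defined through the spaces `Gr(W)`, so
factoring through `A^N(V)` is immediate only there. -/
theorem TN_isGradedModule (N : ℕ) : (S.TN 𝔇 N).IsGradedModule := by
  obtain ⟨f, hf⟩ := h𝔇.exists_isEquivalence N
  exact hf.isGradedModule (S.GrN_isGradedModule N)

end IsDecomposition

end LBGModule

/-! ### Irreducible graded submodules -/

section System

variable {G : ℕ → Type u} [∀ n, AddCommGroup (G n)] [∀ n, Module ℂ (G n)]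

theorem lof_apply_of_ne {m n : ℕ} (h : m ≠ n) (y : G m) : DirectSum.lof ℂ ℕ G m y n = 0 :=
  (DirectSum.component.of (M := G) ℂ n m y).trans (dif_neg h)

theorem sum_lofUpTo_component {N : ℕ} (x : upTo G N) :
    ∑ n : Fin (N + 1), lofUpTo G (Nat.lt_succ_iff.1 n.2) (x.1 n) = x := by
  suffices (∑ n : Fin (N + 1), lofUpTo G (Nat.lt_succ_iff.1 n.2) ∘ₗ
      DirectSum.component ℂ ℕ G n ∘ₗ (upTo G N).subtype) = LinearMap.id by
    have := LinearMap.congr_fun this x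
    rwa [LinearMap.sum_apply] at this
  refine upTo_hom_ext fun m hm y => ?_
  rw [LinearMap.sum_apply, Finset.sum_eq_single ⟨m, Nat.lt_succ_of_le hm⟩]
  · exact congrArg (lofUpTo G hm) (DirectSum.component.lof_self ℂ m y)
  · intro n _ hn
    have hne : (n : ℕ) ≠ m := fun h => hn (Fin.ext h)
    exact (congrArg (lofUpTo G (Nat.lt_succ_iff.1 n.2)) (lof_apply_of_ne hne.symm y)).trans
      (map_zero _)
  · simp

theorem mem_of_lofUpTo_component_mem {N : ℕ} {X : Submodule ℂ (upTo G N)} {x : upTo G N}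
    (h : ∀ n (hn : n ≤ N), lofUpTo G hn (x.1 n) ∈ X) : x ∈ X := by
  rw [← sum_lofUpTo_component x]
  exact X.sum_mem fun n _ => h n _

end System

/-! ### The graded submodules `T_N(P)` of `T_N(W)` and their irreducibility -/

namespace LBGModule

variable {V : Type u} [AddCommGroup V] [Module ℂ V] [GradingRestrictedVertexAlgebra V]
variable {W : Type u} [AddCommGroup W] [Module ℂ W] {S : LBGModule V W}

variable (S) in
/-- The subspace `T_N(P)` of `T_N(W)`: vectors with all components in the submodule `P`. -/
def TNSub (𝔇 : Set (Submodule ℂ W)) (N : ℕ) (P : Submodule ℂ W) :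
    Submodule ℂ (upTo (fun n => S.GSub 𝔇 n) N) where
  carrier := {x | ∀ n, ((x : ⨁ n, S.GSub 𝔇 n) n : W) ∈ P}
  add_mem' hx hy n := P.add_mem (hx n) (hy n)
  zero_mem' _ := P.zero_mem
  smul_mem' c _ hx n := P.smul_mem c (hx n)

variable {𝔇 : Set (Submodule ℂ W)} {N : ℕ}

theorem lofUpTo_mem_TNSub {P : Submodule ℂ W} {n : ℕ} (hn : n ≤ N) {y : S.GSub 𝔇 n}
    (hy : (y : W) ∈ P) : lofUpTo (fun n => S.GSub 𝔇 n) hn y ∈ S.TNSub 𝔇 N P := by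
  intro m
  by_cases h : n = m
  · subst h
    rw [coe_lofUpTo, DirectSum.lof_apply]
    exact hy
  · rw [coe_lofUpTo, lof_apply_of_ne h]
    exact P.zero_mem

theorem of_lofUpTo_mem_TNSub {P : Submodule ℂ W} {n : ℕ} (hn : n ≤ N) {y : S.GSub 𝔇 n}
    (h : lofUpTo (fun n => S.GSub 𝔇 n) hn y ∈ S.TNSub 𝔇 N P) : (y : W) ∈ P := by
  have h1 := h n
  rwa [coe_lofUpTo, DirectSum.lof_apply] at h1

theorem map_mem_TNSub {P : Submodule ℂ W} {f : Module.End ℂ (upTo (fun n => S.GSub 𝔇 n) N)}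
    (h : ∀ n (hn : n ≤ N) (y : S.GSub 𝔇 n), (y : W) ∈ P → f (lofUpTo _ hn y) ∈ S.TNSub 𝔇 N P)
    {x : upTo (fun n => S.GSub 𝔇 n) N} (hx : x ∈ S.TNSub 𝔇 N P) : f x ∈ S.TNSub 𝔇 N P :=
  mem_of_lofUpTo_component_mem (X := (S.TNSub 𝔇 N P).comap f) fun n hn => h n hn _ (hx n)

theorem TNSub_isGradedSubmodule {P : Submodule ℂ W} (hP : S.IsSubmodule P) :
    (S.TN 𝔇 N).IsGradedSubmodule (S.TNSub 𝔇 N P) where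
  theta_mem a x hx := by
    refine map_mem_TNSub (fun l hl y hy => ?_) hx
    have h1 : (S.TN 𝔇 N).theta a (lofUpTo (fun n => S.GSub 𝔇 n) hl y) =
        ∑ k : Fin (N + 1), lofUpTo (fun n => S.GSub 𝔇 n) (Nat.lt_succ_iff.1 k.2)
          (S.GSubAct 𝔇 k l (a.1 l k) y) := by
      refine Subtype.ext ?_
      rw [TN, truncData_theta_coe, coe_lofUpTo, matAct_lof, AddSubmonoidClass.coe_finsetSum,
        Finset.sum_fin_eq_sum_range, Finsupp.sum_of_support_subset (s := Finset.range (N + 1))]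
      · refine Finset.sum_congr rfl fun k hk => ?_
        rw [dif_pos (Finset.mem_range.1 hk)]
        rfl
      · intro k hk
        rw [Finset.mem_range]
        by_contra hlt
        exact (Finsupp.mem_support_iff.1 hk) (a.2 k l (Or.inl (by omega)))
      · simp
    rw [h1]
    exact Submodule.sum_mem _ fun k _ =>
      lofUpTo_mem_TNSub _ (S.opShift_mem_sub _ _ P hP _ hy)
  graded := by
    refine le_antisymm (fun x hx => ?_) (iSup_le fun n => inf_le_left)
    exact mem_of_lofUpTo_component_mem fun n hn => Submodule.mem_iSup_of_mem n
      ⟨lofUpTo_mem_TNSub hn (hx n), lofUpTo_mem_gr hn _⟩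
  L0_mem x hx := by
    refine map_mem_TNSub (fun n hn y hy => ?_) hx
    rw [TN, truncData_L0_lofUpTo]
    exact lofUpTo_mem_TNSub hn (hP.L0_mem _ hy)
  Lm1_mem x hx := by
    refine map_mem_TNSub (fun n hn y hy => ?_) hx
    rcases hn.lt_or_eq with h | rfl
    · rw [TN, truncData_Lm1_lofUpTo h]
      exact lofUpTo_mem_TNSub _ (hP.Lm1_mem _ hy)
    · rw [TN, truncData_Lm1_lofUpTo_top]
      exact Submodule.zero_mem _

theorem TNSub_top : S.TNSub 𝔇 N ⊤ = ⊤ := top_le_iff.1 fun _ _ _ => trivial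

namespace IsDecomposition

variable (h𝔇 : S.IsDecomposition 𝔇)
include h𝔇

theorem TNSub_ne_bot {P : Submodule ℂ W} (hP : P ∈ 𝔇) : S.TNSub 𝔇 N P ≠ ⊥ := by
  obtain ⟨h, hh⟩ := h𝔇.exists_lowestWeights
  obtain ⟨x, hx, hx0⟩ := (Submodule.ne_bot_iff _).1 (hh ⟨P, hP⟩).2.2
  have hxG : x ∈ S.GSub 𝔇 0 := by
    rw [GSub_eq_iSup hh]
    exact Submodule.mem_iSup_of_mem ⟨P, hP⟩ (by simpa using hx)
  refine (Submodule.ne_bot_iff _).2 ⟨lofUpTo (fun n => S.GSub 𝔇 n) (Nat.zero_le N) ⟨x, hxG⟩,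
    lofUpTo_mem_TNSub _ hx.1, fun h0 => hx0 ?_⟩
  have h1 : lofUpTo (fun n => S.GSub 𝔇 n) (Nat.zero_le N) ⟨x, hxG⟩ ∈ S.TNSub 𝔇 N ⊥ := by
    rw [h0]
    exact Submodule.zero_mem _
  exact of_lofUpTo_mem_TNSub _ h1

theorem iSupIndep_TNSub : iSupIndep fun P : 𝔇 => S.TNSub 𝔇 N P := by
  intro P
  rw [Submodule.disjoint_def]
  intro x hx hx'
  refine (Submodule.mem_bot ℂ).1 (mem_of_lofUpTo_component_mem fun n hn => ?_)
  have h1 : (⨆ (Q : 𝔇) (_ : Q ≠ P), S.TNSub 𝔇 N Q) ≤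
      (⨆ (Q : 𝔇) (_ : Q ≠ P), (Q : Submodule ℂ W)).comap ((S.GSub 𝔇 n).subtype ∘ₗ
        DirectSum.component ℂ ℕ (fun n => S.GSub 𝔇 n) n ∘ₗ (upTo _ N).subtype) := by
    refine iSup₂_le fun Q hQ y hy => ?_
    exact Submodule.mem_iSup_of_mem Q (Submodule.mem_iSup_of_mem hQ (hy n))
  have h2 := (Submodule.disjoint_def.1 ((sSupIndep_iff _).1 h𝔇.2.1 P)) _ (hx n) (h1 hx')
  have h3 : x.1 n = 0 := Subtype.ext h2
  rw [h3]
  exact map_zero (lofUpTo _ hn)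

theorem iSup_TNSub : ⨆ P : 𝔇, S.TNSub 𝔇 N P = ⊤ := by
  refine top_le_iff.1 fun x _ => mem_of_lofUpTo_component_mem fun n hn => ?_
  obtain ⟨h, hh⟩ := h𝔇.exists_lowestWeights
  have h1 : S.GSub 𝔇 n ≤ ((⨆ P : 𝔇, S.TNSub 𝔇 N P).comap
      (lofUpTo (fun n => S.GSub 𝔇 n) hn)).map (S.GSub 𝔇 n).subtype := by
    conv_lhs => rw [GSub_eq_iSup hh]
    refine iSup_le fun P y hy => ?_
    have hyG : y ∈ S.GSub 𝔇 n := by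
      rw [GSub_eq_iSup hh]
      exact Submodule.mem_iSup_of_mem P hy
    exact ⟨⟨y, hyG⟩, Submodule.mem_iSup_of_mem P (lofUpTo_mem_TNSub hn hy.1), rfl⟩
  obtain ⟨y, hy, hyx⟩ := h1 (x.1 n).2
  rwa [Subtype.ext hyx] at hy

omit h𝔇 in
-- The bounds `≤ N` are premises inside the claim, so the exact vector `L(-1)^j b` is available in
-- every degree, while membership in `X` is asserted only up to `N`. A final degree at most `N`
-- forces all earlier degrees to be at most `N`.
theorem lofUpTo_Lm1_pow_mem {X : Submodule ℂ (upTo (fun n => S.GSub 𝔇 n) N)}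
    (hX : (S.TN 𝔇 N).IsGradedSubmodule X) {n : ℕ} (b : S.GSub 𝔇 n)
    (hb : ∀ hn : n ≤ N, lofUpTo (fun n => S.GSub 𝔇 n) hn b ∈ X) (j : ℕ) :
    ∃ c : S.GSub 𝔇 (n + j), (c : W) = (S.Lm1 ^ j) b ∧
      ∀ hn : n + j ≤ N, lofUpTo (fun n => S.GSub 𝔇 n) hn c ∈ X := by
  induction j with
  | zero => exact ⟨b, by simp, hb⟩
  | succ j ih =>
    obtain ⟨c, hc, hcX⟩ := ih
    refine ⟨S.Lm1.restrict (S.Lm1_mem_GSub 𝔇 (n + j)) c, ?_, fun hn => ?_⟩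
    · rw [pow_succ', Module.End.mul_apply, ← hc]
      rfl
    · have h1 := hX.Lm1_mem _ (hcX (by omega))
      rw [TN, truncData_Lm1_lofUpTo (show n + j < N by omega)] at h1
      exact h1

/-- The degree-zero part `A` of `X` generates `P` as a `V`-module, and the action of `[v]_{k0}`
followed by `L(-1)` realizes inside `X` every generator of degree at most `N`. -/
theorem TNSub_le {P : Submodule ℂ W} (hP : P ∈ 𝔇)
    {X : Submodule ℂ (upTo (fun n => S.GSub 𝔇 n) N)} (hX : (S.TN 𝔇 N).IsGradedSubmodule X)
    (hXP : X ≤ S.TNSub 𝔇 N P) (hne : X ≠ ⊥) : S.TNSub 𝔇 N P ≤ X := by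
  have hG := h𝔇.TN_isGradedModule N
  let A : Submodule ℂ W := (X.comap (lofUpTo (fun n => S.GSub 𝔇 n) (Nat.zero_le N))).map
    (S.GSub 𝔇 0).subtype
  have hAP : A ≤ P := by
    rintro _ ⟨y, hy, rfl⟩
    exact of_lofUpTo_mem_TNSub _ (hXP hy)
  have hA0 : ∀ a ∈ A, S.L0 a ∈ A := by
    rintro _ ⟨y, hy, rfl⟩
    refine ⟨S.L0.restrict (S.L0_mem_GSub 𝔇 0) y, ?_, rfl⟩
    have h1 := hX.L0_mem _ hy
    rw [TN, truncData_L0_lofUpTo] at h1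
    exact h1
  have hAne : A ≠ ⊥ := by
    obtain ⟨l, hl⟩ : ∃ l, X ⊓ (S.TN 𝔇 N).gr l ≠ ⊥ := by
      by_contra! hall
      refine hne ?_
      rw [hX.graded]
      simp [hall]
    have hlN : l ≤ N := by
      by_contra hlt
      refine hl ?_
      rw [hG.gr_eq_bot l (not_le.1 hlt), inf_bot_eq]
    obtain ⟨w, ⟨hwX, hwl⟩, hw0⟩ := (Submodule.ne_bot_iff _).1 hl
    -- Nondegeneracy moves a nonzero homogeneous vector of `X` to a nonzero vector in degree `0`.
    obtain ⟨v, hv⟩ : ∃ v, (S.TN 𝔇 N).theta (elemN (Nat.zero_le N) hlN v) w ≠ 0 := by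
      by_contra! hall
      exact hw0 (hG.nondegenerate l hlN w hwl hall)
    have hmem := hX.theta_mem (elemN (Nat.zero_le N) hlN v) w hwX
    obtain ⟨y, hy⟩ := exists_lofUpTo_of_mem_gr (Nat.zero_le N)
      (hG.elem_mem 0 l (Nat.zero_le N) hlN v w hwl)
    rw [← hy] at hmem hv
    refine (Submodule.ne_bot_iff _).2 ⟨y, ⟨y, hmem, rfl⟩, fun h0 => hv ?_⟩
    rw [Subtype.ext (a2 := (0 : S.GSub 𝔇 0)) h0, map_zero]
  have hgen := S.generated_eq_of_isIrreducibleSub (h𝔇.1 P hP) hAP hA0 hAne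
  let E := LinearEquiv.ofBijective (DirectSum.coeLinearMap (S.GSub 𝔇)) h𝔇.isInternal_GSub
  -- `Q` imposes no condition in degrees above `N`. It need not be stable under modes; containing
  -- the spanning vectors of `P` is enough.
  let Q : Submodule ℂ W := ⨅ (n : ℕ) (hn : n ≤ N), X.comap
    (lofUpTo (fun n => S.GSub 𝔇 n) hn ∘ₗ DirectSum.component ℂ ℕ (fun n => S.GSub 𝔇 n) n ∘ₗ
      E.symm.toLinearMap)
  have hmemQ : ∀ w, w ∈ Q ↔ ∀ n (hn : n ≤ N), lofUpTo (fun n => S.GSub 𝔇 n) hn (E.symm w n) ∈ X :=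
    fun w => by
      simp only [Q, Submodule.mem_iInf]
      rfl
  have hQ : P ≤ Q := by
    rw [← hgen]
    refine S.generated_le ?_
    rintro _ ⟨a, ha, rfl⟩ j s v
    rw [Submodule.subtype_apply]
    -- Modes of negative weight kill `G_0 ⊆ Ω_0`; the others raise degree `0` to degree `s`.
    by_cases hs : s < 0
    · rw [S.opShift_eq_zero_of_mem_Omega (n := 0) (by omega)
        (by simpa using h𝔇.GSub_le_Omega 0 a.2), map_zero]
      exact Q.zero_mem
    · obtain ⟨k, rfl⟩ := Int.eq_ofNat_of_zero_le (not_lt.1 hs)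
      obtain ⟨c, hc, hcX⟩ := lofUpTo_Lm1_pow_mem hX (S.GSubAct 𝔇 k 0 v a) (fun hk => by
        have h1 := hX.theta_mem (elemN hk (Nat.zero_le N) v) _ ha
        rw [TN, truncData_elem_lofUpTo] at h1
        exact h1) j
      have h2 : (S.Lm1 ^ j) (S.opShift k v a) = c := by
        rw [hc]
        show _ = (S.Lm1 ^ j) (S.opShift ((k : ℤ) - ((0 : ℕ) : ℤ)) v a)
        simp
      rw [h2, hmemQ]
      intro n hn
      by_cases hnk : k + j = n
      · subst hnk
        rw [h𝔇.isInternal_GSub.ofBijective_coeLinearMap_same c]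
        exact hcX hn
      · rw [h𝔇.isInternal_GSub.ofBijective_coeLinearMap_of_ne hnk c, map_zero]
        exact X.zero_mem
  intro x hx
  refine mem_of_lofUpTo_component_mem fun n hn => ?_
  have h1 := (hmemQ _).1 (hQ (hx n)) n hn
  rwa [h𝔇.isInternal_GSub.ofBijective_coeLinearMap_same] at h1

theorem TNSub_isIrreducibleSub {P : Submodule ℂ W} (hP : P ∈ 𝔇) :
    (S.TN 𝔇 N).IsIrreducibleSub (S.TNSub 𝔇 N P) := by
  refine ⟨TNSub_isGradedSubmodule (h𝔇.isSubmodule hP), h𝔇.TNSub_ne_bot hP, fun X hXP hX => ?_⟩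
  by_cases hne : X = ⊥
  · exact Or.inl hne
  · exact Or.inr (le_antisymm hXP (h𝔇.TNSub_le hP hX hXP hne))

theorem TN_isCompletelyReducible (N : ℕ) : (S.TN 𝔇 N).IsCompletelyReducible := by
  refine ⟨Set.range fun P : 𝔇 => S.TNSub 𝔇 N P, ?_, h𝔇.iSupIndep_TNSub.sSupIndep_range, ?_⟩
  · rintro _ ⟨P, rfl⟩
    exact h𝔇.TNSub_isIrreducibleSub P.2
  · rw [sSup_range, h𝔇.iSup_TNSub]

end IsDecomposition

theorem IsIrreducible.isDecomposition (h : S.IsIrreducible) : S.IsDecomposition {⊤} :=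
  ⟨by rintro _ rfl; exact h, sSupIndep_singleton _, sSup_singleton⟩

end LBGModule
end

/-! ### The proposition -/

theorem proposition5p3 {V W : Type u} [AddCommGroup V] [Module ℂ V]
    [GradingRestrictedVertexAlgebra V] [AddCommGroup W] [Module ℂ W] (S : LBGModule V W) (N : ℕ) :
    (S.IsIrreducible →
      DirectSum.IsInternal (S.GSub {⊤}) ∧
      (S.GrN N).IsGradedModule ∧ (S.TN {⊤} N).IsGradedModule ∧
      (S.GrN N).Equivalent (S.TN {⊤} N) ∧
      (S.GrN N).IsIrreducible) ∧
    (S.IsCompletelyReducible →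
      (S.GrN N).IsGradedModule ∧
      (∀ 𝔇 : Set (Submodule ℂ W), S.IsDecomposition 𝔇 →
        DirectSum.IsInternal (S.GSub 𝔇) ∧
        (S.TN 𝔇 N).IsGradedModule ∧ (S.GrN N).Equivalent (S.TN 𝔇 N)) ∧
      (S.GrN N).IsCompletelyReducible) := by
  refine ⟨fun h => ?_, fun h => ⟨S.GrN_isGradedModule N, fun 𝔇 h𝔇 => ?_, ?_⟩⟩
  · obtain ⟨f, hf⟩ := h.isDecomposition.exists_isEquivalence N
    -- An irreducible `W` is its own only summand, and `T_N(P)` for `P = ⊤` is the whole of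
    -- `T_N(W)`.
    have hirr := h.isDecomposition.TNSub_isIrreducibleSub (N := N) rfl
    rw [LBGModule.TNSub_top] at hirr
    exact ⟨h.isDecomposition.isInternal_GSub, S.GrN_isGradedModule N,
      h.isDecomposition.TN_isGradedModule N, hf.equivalent, hf.symm.isIrreducible hirr⟩
  · obtain ⟨f, hf⟩ := h𝔇.exists_isEquivalence N
    exact ⟨h𝔇.isInternal_GSub, h𝔇.TN_isGradedModule N, hf.equivalent⟩
  · obtain ⟨𝔇, h𝔇⟩ := h
    obtain ⟨f, hf⟩ := h𝔇.exists_isEquivalence N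
    exact hf.symm.isCompletelyReducible (h𝔇.TN_isCompletelyReducible N)
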